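/- Conventions. The independent variables are complex times $t=(t_1,t_3,t_5,\dots)$ with $t_1=x$. Let $D=\partial_x$ be the total derivative on differential polynomials over $\mathbb C$ in $q,r$, let $\partial_x^{-1}P$ be the antiderivative without constant term of a differential polynomial $P$, and put $$K_n=(K_{1,n},K_{2,n})^T=L^n(-q,r)^T,\qquad L\begin{pmatrix}u_1\\u_2\end{pmatrix}=\begin{pmatrix}-Du_1+2q\,\partial_x^{-1}(ru_1+qu_2)\\ Du_2-2r\,\partial_x^{-1}(ru_1+qu_2)\end{pmatrix}.$$ The KdV hierarchy (for the reduction $q=1$) is $r_{t_{2l+1}}=K_{2,2l+1}|_{q=1}$, $l=0,1,2,\dots$; for $l=1$ it is $r_{t_3}=r_{xxx}-6rr_x$. Let $m\ge 0$ and $N=2m+3$. For $\varphi,\psi$ with values in $\mathbb C^N$ let $|\widehat\varphi^{(a)};\widehat\psi^{(b)}|$ be the determinant with columns $\varphi,\partial_x\varphi,\dots,\partial_x^a\varphi,\psi,\partial_x\psi,\dots,\partial_x^b\psi$, where $a+b=2m+1$ (no $\psi$ column if $b=-1$). Put $$f=|\widehat\varphi^{(m+1)};\widehat\psi^{(m)}|,\quad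 h=|\widehat\varphi^{(m)};\widehat\psi^{(m+1)}|,\quad q=\frac hf,\quad r=(-1)^m\,\frac{4|\widehat\varphi^{(m+2)};\widehat\psi^{(m-1)}|}{f}.$$ For $A,T\in\mathbb C^{N\times N}$ and $C^+\in\mathbb C^N$ let $$\varphi=\exp\Bigl(\tfrac12\sum_{j\ge0}A^{2j+1}t_{2j+1}\Bigr)C^+,\qquad \psi=\exp\Bigl(-\tfrac12\sum_{j\ge0}A^{2j+1}t_{2j+1}\Bigr)TC^+\qquad(*)$$ at the times where the series converges. "Solves the KdV hierarchy" means: at every such time with $f\neq0$, $r$ is analytic in $x$, and for each $l$ the derivative $r_{t_{2l+1}}$ exists and equals $K_{2,2l+1}|_{q=1}$. Statement. (0) Each $\partial_x^{-1}$ in the definition of the $K_n$ is well defined: $rK_{1,n}+qK_{2,n}$ has exactly one antiderivative that is a differential polynomial without constant term. (1) If $AT+TA=0$, $T^2=I$ and $P$ is invertible, then $PAP^{-1}$, $PTP^{-1}$ satisfy the same equations and, with $PC^+$ in place of $C^+$, give via $(*)$ the same $q$ and $r$, so one may take $A$ in canonical form. (2) For every $\mathbf K\in\mathbb C^{(m+1)\times(m+1)}$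 the matrices $$T=\begin{pmatrix}0&0&I_{m+1}\\0&1&0\\I_{m+1}&0&0\end{pmatrix},\qquad A=\begin{pmatrix}\mathbf K&0&0\\0&0&0\\0&0&-\mathbf K\end{pmatrix}$$ satisfy $AT+TA=0$, $T^2=I$, and $|T|=(-1)^{m+1}$. For every $C^+\in\mathbb C^N$ the vectors $(*)$ satisfy $\psi=T\varphi$; one has $h/f=|T|$ where $f\ne0$; and $r$ solves the KdV hierarchy for the reduction $q=1$. (3) Let $\xi(k)=\frac12kx+\frac12\sum_{j\ge1}k^{2j+1}t_{2j+1}$. If $\mathbf K=\mathrm{Diag}(k_1,\dots,k_{m+1})$ and $c_i,d_i\in\mathbb C$, then, where all $\xi(k_i)$ converge, $\varphi$ with $C^+=(c_1,\dots,c_{m+1},1,d_1,\dots,d_{m+1})^T$ is $$\varphi=(c_1e^{\xi(k_1)},\dots,c_{m+1}e^{\xi(k_{m+1})},1,d_1e^{\xi(-k_1)},\dots,d_{m+1}e^{\xi(-k_{m+1})})^T,$$ and with this $\varphi$ and $\psi=T\varphi$, $r$ solves the KdV hierarchy for $q=1$. (4) If $\mathbf K$ is the Jordan block with $k$ on the diagonal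 and $1$ on the subdiagonal, and $c,d$ are holomorphic functions near $k$ (for example constants), then, where $\xi$ converges in a neighbourhood of $k$, $\varphi$ with $C^+=(c,\frac{\partial_kc}{1!},\dots,\frac{\partial_k^mc}{m!},1,d,\frac{\partial_kd}{1!},\dots,\frac{\partial_k^md}{m!})^T$ is $$\varphi=\Bigl(ce^{\xi(k)},\tfrac{\partial_k}{1!}(ce^{\xi(k)}),\dots,\tfrac{\partial_k^m}{m!}(ce^{\xi(k)}),1,de^{\xi(-k)},\tfrac{\partial_k}{1!}(de^{\xi(-k)}),\dots,\tfrac{\partial_k^m}{m!}(de^{\xi(-k)})\Bigr)^T,$$ and with this $\varphi$ and $\psi=T\varphi$, $r$ solves the KdV hierarchy for $q=1$. -/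

import Mathlib

open scoped Topology Matrix

noncomputable section

/-! ### The AKNS hierarchy as differential polynomials -/

/-- Differential polynomials over `ℂ` in two functions `q`, `r` of `x`: the variable `(0, j)` is
`∂ₓʲ q` and the variable `(1, j)` is `∂ₓʲ r`. -/
abbrev DiffPoly : Type := MvPolynomial (Fin 2 × ℕ) ℂ

def qVar : DiffPoly := MvPolynomial.X (0, 0)

def rVar : DiffPoly := MvPolynomial.X (1, 0)

/-- The total `x`-derivative `∂ₓ`. -/
def totalDeriv : Derivation ℂ DiffPoly DiffPoly :=
  MvPolynomial.mkDerivation ℂ fun v => MvPolynomial.X (v.1, v.2 + 1)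

open Classical in
/-- `∂ₓ⁻¹ P`: the antiderivative of `P` without constant term (with the value `0` if `P` is not a
total derivative). -/
def totalDerivInv (P : DiffPoly) : DiffPoly :=
  if h : ∃ Q : DiffPoly, totalDeriv Q = P ∧ MvPolynomial.constantCoeff Q = 0
  then Classical.choose h else 0

/-- The argument `r u₁ + q u₂` of `∂ₓ⁻¹` in the recursion operator. -/
def aknsDensity (u : DiffPoly × DiffPoly) : DiffPoly := rVar * u.1 + qVar * u.2

/-- The recursion operator
`L = (-∂ + 2q∂⁻¹r, 2q∂⁻¹q ; -2r∂⁻¹r, ∂ - 2r∂⁻¹q)` applied to the column `(u₁, u₂)`. -/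
def aknsRecursion (u : DiffPoly × DiffPoly) : DiffPoly × DiffPoly :=
  (-totalDeriv u.1 + 2 * qVar * totalDerivInv (aknsDensity u),
    totalDeriv u.2 - 2 * rVar * totalDerivInv (aknsDensity u))

/-- The AKNS flows `Kₙ = Lⁿ (-q, r)`. -/
def aknsFlow (n : ℕ) : DiffPoly × DiffPoly := aknsRecursion^[n] (-qVar, rVar)

/-! ### Functions of the odd times -/

/-- The sequence of odd times: `t j` is `t_{2j+1}`, and `t 0 = t₁ = x`. -/
abbrev Times : Type := ℕ → ℂ

/-- `∂ₓⁱ F` at the point `t`. -/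
def xDeriv {E : Type*} [NormedAddCommGroup E] [NormedSpace ℂ E] (F : Times → E) (i : ℕ)
    (t : Times) : E :=
  iteratedDeriv i (fun x : ℂ => F (Function.update t 0 x)) (t 0)

/-- The value at `t` of the differential polynomial `P` on the pair of functions `(q, r)`. -/
def evalDiffPoly (P : DiffPoly) (q r : Times → ℂ) (t : Times) : ℂ :=
  MvPolynomial.eval (fun v => if v.1 = 0 then xDeriv q v.2 t else xDeriv r v.2 t) P

/-- `r` solves on `Ω` the whole KdV hierarchy belonging to the reduction `q = 1`, that is
`r_{t_{2l+1}} = K_{2,2l+1}|_{q=1}` for `l = 0, 1, 2, …` -/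
def SolvesKdVHierarchy (Ω : Set Times) (r : Times → ℂ) : Prop :=
  ∀ t ∈ Ω,
    AnalyticAt ℂ (fun x : ℂ => r (Function.update t 0 x)) (t 0) ∧
    ∀ l : ℕ, HasDerivAt (fun s : ℂ => r (Function.update t l s))
      (evalDiffPoly (aknsFlow (2 * l + 1)).2 (fun _ => 1) r t) (t l)

/-! ### Double Wronskians -/

/-- The double Wronskian `W^{(p, N-p)}(φ, ψ)`, whose columns are
`φ, ∂ₓφ, …, ∂ₓ^{p-1}φ` followed by `ψ, ∂ₓψ, …, ∂ₓ^{N-p-1}ψ`. -/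
def doubleWronskian {N : ℕ} (p : ℕ) (φ ψ : Times → Fin N → ℂ) (t : Times) : ℂ :=
  (Matrix.of fun i j : Fin N =>
    if (j : ℕ) < p then xDeriv φ (j : ℕ) t i else xDeriv ψ ((j : ℕ) - p) t i).det

/-- `f = |φ̂^{(m+1)}; ψ̂^{(m)}|`. -/
def tauF (m : ℕ) (φ ψ : Times → Fin (2 * m + 3) → ℂ) (t : Times) : ℂ :=
  doubleWronskian (m + 2) φ ψ t

/-- `|φ̂^{(m+2)}; ψ̂^{(m-1)}|` (no `ψ` column if `m = 0`). -/
def tauG (m : ℕ) (φ ψ : Times → Fin (2 * m + 3) → ℂ) (t : Times) : ℂ :=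
  doubleWronskian (m + 3) φ ψ t

/-- `h = |φ̂^{(m)}; ψ̂^{(m+1)}|`. -/
def tauH (m : ℕ) (φ ψ : Times → Fin (2 * m + 3) → ℂ) (t : Times) : ℂ :=
  doubleWronskian (m + 1) φ ψ t

/-- `q = h / f`. -/
def kdvQ (m : ℕ) (φ ψ : Times → Fin (2 * m + 3) → ℂ) (t : Times) : ℂ :=
  tauH m φ ψ t / tauF m φ ψ t

/-- `r = (-1)^m · 4 |φ̂^{(m+2)}; ψ̂^{(m-1)}| / |φ̂^{(m+1)}; ψ̂^{(m)}|`. -/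
def kdvR (m : ℕ) (φ ψ : Times → Fin (2 * m + 3) → ℂ) (t : Times) : ℂ :=
  (-1) ^ m * (4 * tauG m φ ψ t / tauF m φ ψ t)

/-! ### The vectors `φ`, `ψ` belonging to a constant matrix -/

/-- The times at which the series `∑ t_{2j+1} A^{2j+1}` converges. -/
def seriesDomain {N : ℕ} (A : Matrix (Fin N) (Fin N) ℂ) : Set Times :=
  {t | Summable fun j : ℕ => t j • A ^ (2 * j + 1)}

/-- `φ = exp(½ ∑ A^{2j+1} t_{2j+1}) C⁺`. -/
def phiVec {N : ℕ} (A : Matrix (Fin N) (Fin N) ℂ) (C : Fin N → ℂ) (t : Times) : Fin N → ℂ :=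
  NormedSpace.exp ((1 / 2 : ℂ) • ∑' j : ℕ, t j • A ^ (2 * j + 1)) *ᵥ C

/-- `ψ = exp(-½ ∑ A^{2j+1} t_{2j+1}) C⁻`. -/
def psiVec {N : ℕ} (A : Matrix (Fin N) (Fin N) ℂ) (C : Fin N → ℂ) (t : Times) : Fin N → ℂ :=
  NormedSpace.exp (-((1 / 2 : ℂ) • ∑' j : ℕ, t j • A ^ (2 * j + 1))) *ᵥ C

/-! ### The canonical block matrices and the explicit vectors -/

/-- The division of the `2m+3` indices, in their order, into blocks of sizes `m+1`, `1`, `m+1`. -/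
def blockEquiv (m : ℕ) : Fin (m + 1) ⊕ (Fin 1 ⊕ Fin (m + 1)) ≃ Fin (2 * m + 3) :=
  ((Equiv.sumCongr (Equiv.refl _) finSumFinEquiv).trans finSumFinEquiv).trans
    (finCongr (by omega))

/-- `T = (0, 0, I ; 0, 1, 0 ; I, 0, 0)`. -/
def canonicalT (m : ℕ) : Matrix (Fin (2 * m + 3)) (Fin (2 * m + 3)) ℂ :=
  Matrix.reindex (blockEquiv m) (blockEquiv m)
    (Matrix.fromBlocks 0 (Matrix.fromCols 0 1) (Matrix.fromRows 0 1) (Matrix.fromBlocks 1 0 0 0))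

/-- `A = diag(K, 0, -K)`. -/
def canonicalA {m : ℕ} (K : Matrix (Fin (m + 1)) (Fin (m + 1)) ℂ) :
    Matrix (Fin (2 * m + 3)) (Fin (2 * m + 3)) ℂ :=
  Matrix.reindex (blockEquiv m) (blockEquiv m)
    (Matrix.fromBlocks K 0 0 (Matrix.fromBlocks 0 0 0 (-K)))

/-- The column `(u₁, …, u_{m+1}, 1, v₁, …, v_{m+1})ᵀ`. -/
def blockVec {m : ℕ} (u v : Fin (m + 1) → ℂ) : Fin (2 * m + 3) → ℂ :=
  fun i => Sum.elim u (Sum.elim (fun _ => 1) v) ((blockEquiv m).symm i)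

/-- The Jordan block with `k` on the diagonal and `1` just below it. -/
def lowerJordan (n : ℕ) (k : ℂ) : Matrix (Fin n) (Fin n) ℂ :=
  Matrix.of fun i j => if i = j then k else if (i : ℕ) = (j : ℕ) + 1 then 1 else 0

/-- `ξ(k) = ½ k x + ½ ∑_{j ≥ 1} k^{2j+1} t_{2j+1}`, where `x = t₁`. -/
def xi (t : Times) (k : ℂ) : ℂ := (1 / 2) * ∑' j : ℕ, k ^ (2 * j + 1) * t j

/-- `φ` for `K = Diag(k₁, …, k_{m+1})`. -/
def diagPhi {m : ℕ} (k c d : Fin (m + 1) → ℂ) (t : Times) : Fin (2 * m + 3) → ℂ :=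
  blockVec (fun i => c i * Complex.exp (xi t (k i))) (fun i => d i * Complex.exp (xi t (-k i)))

/-- The Taylor column `(F, ∂ₖF / 1!, …, ∂ₖᵐF / m!)ᵀ` at `k`. -/
def taylorColumn (m : ℕ) (F : ℂ → ℂ) (k : ℂ) : Fin (m + 1) → ℂ :=
  fun i => iteratedDeriv (i : ℕ) F k / (Nat.factorial (i : ℕ) : ℂ)

/-- `φ` for the Jordan block with eigenvalue `k`. -/
def jordanPhi (m : ℕ) (k : ℂ) (c d : ℂ → ℂ) (t : Times) : Fin (2 * m + 3) → ℂ :=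
  blockVec (taylorColumn m (fun z => c z * Complex.exp (xi t z)) k)
    (taylorColumn m (fun z => d z * Complex.exp (xi t (-z))) k)

/-- The times at which all the `ξ(kᵢ)` converge. -/
def diagDomain {m : ℕ} (k : Fin (m + 1) → ℂ) : Set Times :=
  {t | ∀ i, Summable fun j : ℕ => k i ^ (2 * j + 1) * t j}

/-- The times at which `ξ` converges on a neighbourhood of `k`. -/
def jordanDomain (k : ℂ) : Set Times :=
  {t | ∀ᶠ z in 𝓝 k, Summable fun j : ℕ => z ^ (2 * j + 1) * t j}

end

/-! In block form `φ = (u, s, v)` and `ψ = Tφ = (v, s, u)`, where `s` is constant and `u' = κu`, `v'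
= -κv` with `κ = K/2`. Multiplication by `T` exchanges the two halves of a double Wronskian, which
gives `h = |T| f` (`tauH_eq`). The difference `e = u - v` satisfies `e'' = κ² e` and `∂e/∂t_{2l+1} =
4^l κ^{2l} e'`. If `e^{(m+1)} = ∑ γ_i e^{(i)}`, Cramer's rule turns the quotient of double
Wronskians into `r = -2 γ_m'` (`kdvR_canonical`), the usual potential `-2 ∂² log W(e)` of the
ordinary Wronskian `W(e)`.

It remains to treat this potential. The operator `P = ∂^{m+1} - ∑ γ_i ∂^i` kills the entries of `e`.
Because `κ²` is constant, `γ'' + 2Γγ' = 0`, where `Γ` is the companion operator. For the symbol `p =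
1 - ∑ γ_i (2z)^{m+1-i}` and `k = 1/(2z)` this says `(p e^{kx})'' = (r + k²) p e^{kx}`
(`wave_equation`). The product of `p(z)` and `p(-z)`, divided by their Wronskian, is the resolvent
`R`, an even power series in `z`. Its linear and quadratic equations yield series `a, b, c` that
obey the AKNS recursion for `q = 1` together with `a² - bc = 1/4`. These conditions have only one
solution (`IsAKNSSequence.eq_of_eq`), so `K_{2,2l+1}` equals `-½ R_{2l+2}'`. Expanding `R` gives
`R_{2l+2} = 4^{l+1} (y_l)_m`, where `4^l y_l` is the derivative of `γ` along `t_{2l+1}`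
(`companion_aknsSequence`). Since mixed derivatives agree, `-2 · 4^l (y_l)_m'` is `r_{t_{2l+1}}`.

The normalisation `a² - bc = 1/4` also makes the hierarchy local: the `a_{n+1}` that it determines
is a polynomial antiderivative of the density (`aknsA_succ`). Passing to a similar pair multiplies
all double Wronskians by `|P|`. In the explicit cases the exponential is diagonal, or is a Toeplitz
matrix of Taylor coefficients of `e^{±ξ}` at `k` (`exp_toeplitz`). -/

noncomputable section

/-! ### Derivations acting on the coefficients of a power series -/

section MapDeriv

open PowerSeries

variable {R 𝒜 : Type*} [CommRing R] [CommRing 𝒜] [Algebra R 𝒜]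

/-- A derivation of `𝒜` applied to all the coefficients of a power series over `𝒜`. -/
def coeffDeriv (D : Derivation R 𝒜 𝒜) : Derivation R 𝒜⟦X⟧ 𝒜⟦X⟧ where
  toFun f := PowerSeries.mk fun n => D (coeff n f)
  map_add' f g := by ext n; simp
  map_smul' c f := by ext n; simp
  map_one_eq_zero' := by
    ext n
    rcases eq_or_ne n 0 with rfl | h
    · simp
    · simp [coeff_one, h]
  leibniz' f g := by
    ext n
    simp only [LinearMap.coe_mk, AddHom.coe_mk, coeff_mk, smul_eq_mul, map_add, coeff_mul, map_sum,
      Derivation.leibniz, Finset.sum_add_distrib]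
    congr 1
    exact Finset.sum_equiv (Equiv.prodComm ℕ ℕ)
      (fun _ => by simp [add_comm]) (fun _ _ => rfl)

@[simp]
theorem coeff_coeffDeriv (D : Derivation R 𝒜 𝒜) (n : ℕ) (f : 𝒜⟦X⟧) :
    coeff n (coeffDeriv D f) = D (coeff n f) := by
  simp [coeffDeriv]

theorem coeffDeriv_X (D : Derivation R 𝒜 𝒜) : coeffDeriv D (X : 𝒜⟦X⟧) = 0 := by
  ext n
  rw [coeff_coeffDeriv, coeff_X]
  split_ifs <;> simp

theorem coeffDeriv_C (D : Derivation R 𝒜 𝒜) (x : 𝒜) : coeffDeriv D (C x) = C (D x) := by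
  ext n
  rw [coeff_coeffDeriv, coeff_C, coeff_C]
  split_ifs <;> simp

end MapDeriv

/-! ### The AKNS recursion in a differential ring -/

section AKNS

open PowerSeries

variable {R 𝒜 : Type*} [CommRing R] [CommRing 𝒜] [Algebra R 𝒜]

/-- The recursion for the off-diagonal entries `b`, `c` of the AKNS resolvent. -/
structure IsAKNSSequence (D : Derivation R 𝒜 𝒜) (q r : 𝒜) (a b c : ℕ → 𝒜) : Prop where
  b_zero : b 0 = 0
  c_zero : c 0 = 0
  b_succ : ∀ n, b (n + 1) = -D (b n) + 2 * q * a n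
  c_succ : ∀ n, c (n + 1) = D (c n) - 2 * r * a n

/-- For the generating series the recursions say `b = z(-b' + 2qa)` and `c = z(c' - 2ra)`. Computing
`bc` from each and subtracting gives the identity. Once `a' = rb + qc` is known, it reads `(a² -
bc)' = 0`. -/
theorem IsAKNSSequence.sum_eq_deriv {D : Derivation R 𝒜 𝒜} {q r : 𝒜} {a b c : ℕ → 𝒜}
    (h : IsAKNSSequence D q r a b c) (n : ℕ) :
    ∑ x ∈ Finset.HasAntidiagonal.antidiagonal n, 2 * a x.1 * (r * b x.2 + q * c x.2) =
      D (∑ x ∈ Finset.HasAntidiagonal.antidiagonal n, b x.1 * c x.2) := by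
  set D' := coeffDeriv D
  have hb : PowerSeries.mk b = X * (-D' (PowerSeries.mk b) + 2 * C q * PowerSeries.mk a) := by
    ext n
    cases n with
    | zero => simp [h.b_zero]
    | succ n =>
      rw [coeff_succ_X_mul, mul_assoc, two_mul]
      simp [D', h.b_succ n]
      ring
  have hc : PowerSeries.mk c = X * (D' (PowerSeries.mk c) - 2 * C r * PowerSeries.mk a) := by
    ext n
    cases n with
    | zero => simp [h.c_zero]
    | succ n =>
      rw [coeff_succ_X_mul, mul_assoc, two_mul]
      simp [D', h.c_succ n]
      ring
  have key : X * (2 * PowerSeries.mk a * (C r * PowerSeries.mk b + C q * PowerSeries.mk c)) = X * D' (PowerSeries.mk b * PowerSeries.mk c) := by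
    rw [Derivation.leibniz, smul_eq_mul, smul_eq_mul]
    linear_combination (PowerSeries.mk b) * hc - (PowerSeries.mk c) * hb
  have h2 : ∀ k, coeff (k + 1) (X * (2 * PowerSeries.mk a * (C r * PowerSeries.mk b + C q * PowerSeries.mk c))) =
      coeff (k + 1) (X * D' (PowerSeries.mk b * PowerSeries.mk c)) := fun k => by rw [key]
  have h3 := h2 n
  rw [coeff_succ_X_mul, coeff_succ_X_mul, coeff_coeffDeriv, coeff_mul, coeff_mul] at h3
  simp only [coeff_mk] at h3
  rw [← h3]
  refine Finset.sum_congr rfl fun x _ => ?_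
  rw [two_mul, two_mul]
  simp

/-- The quadratic normalisation `a² - b c = 1/4`, `a 0 = -1/2`, solved for `a (n + 1)`. -/
def aknsDiagonal (a b c : ℕ → 𝒜) (n : ℕ) : 𝒜 :=
  ∑ i ∈ Finset.range n, (a (i + 1) * a (n - i) - b (i + 1) * c (n - i))

/-- Recursion and normalisation give every entry from earlier ones without integrating, so no
constants of integration arise, however large the kernel of `D` is. -/
theorem IsAKNSSequence.eq_of_eq {D : Derivation R 𝒜 𝒜} {q r : 𝒜} {a b c a' b' c' : ℕ → 𝒜}
    (h : IsAKNSSequence D q r a b c) (h' : IsAKNSSequence D q r a' b' c') (h0 : a 0 = a' 0)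
    (ha : ∀ n, a (n + 1) = aknsDiagonal a b c n) (ha' : ∀ n, a' (n + 1) = aknsDiagonal a' b' c' n)
    (n : ℕ) : a n = a' n ∧ b n = b' n ∧ c n = c' n := by
  induction n using Nat.strong_induction_on with
  | _ n ih =>
    cases n with
    | zero => exact ⟨h0, by rw [h.b_zero, h'.b_zero], by rw [h.c_zero, h'.c_zero]⟩
    | succ n =>
      obtain ⟨h1, h2, h3⟩ := ih n n.lt_succ_self
      refine ⟨?_, by rw [h.b_succ, h'.b_succ, h1, h2], by rw [h.c_succ, h'.c_succ, h1, h3]⟩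
      rw [ha, ha']
      refine Finset.sum_congr rfl fun i hi => ?_
      have hi' := Finset.mem_range.mp hi
      rw [(ih (i + 1) (by omega)).1, (ih (n - i) (by omega)).1, (ih (i + 1) (by omega)).2.1,
        (ih (n - i) (by omega)).2.2]

/-- If the lower diagonal entries satisfy `D a = r b + q c`, so does the one determined by the
quadratic normalisation. -/
theorem IsAKNSSequence.deriv_aknsDiagonal {D : Derivation R 𝒜 𝒜} {q r : 𝒜} {a b c : ℕ → 𝒜}
    (h : IsAKNSSequence D q r a b c) (h0 : 2 * a 0 = -1) (n : ℕ)
    (hD : ∀ i < n, D (a (i + 1)) = r * b (i + 1) + q * c (i + 1)) :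
    D (aknsDiagonal a b c n) = r * b (n + 1) + q * c (n + 1) := by
  have hsplit : ∀ f : ℕ → 𝒜, ∑ i ∈ Finset.range (n + 1).succ, f i =
      ∑ i ∈ Finset.range n, f (i + 1) + f 0 + f (n + 1) := fun f => by
    rw [Finset.sum_range_succ, Finset.sum_range_succ']
  -- The end terms of the sum are split off: the first is `2 a 0 (r b_{n+1} + q c_{n+1})`, which is
  -- minus the desired right side, and the others vanish because `b 0 = c 0 = 0`.
  have h1 := h.sum_eq_deriv (n + 1)
  rw [Finset.Nat.sum_antidiagonal_eq_sum_range_succ_mk,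
    Finset.Nat.sum_antidiagonal_eq_sum_range_succ_mk, hsplit, hsplit] at h1
  simp only [h.b_zero, h.c_zero, Nat.sub_zero, Nat.sub_self, mul_zero, zero_mul, add_zero, h0,
    Nat.reduceSubDiff] at h1
  have h2 : D (∑ i ∈ Finset.range n, a (i + 1) * a (n - i)) =
      ∑ i ∈ Finset.range n, 2 * a (i + 1) * (r * b (n - i) + q * c (n - i)) := by
    have hs : ∀ i ∈ Finset.range n, D (a (i + 1) * a (n - i)) =
        a (i + 1) * (r * b (n - i) + q * c (n - i)) +
          a (n - i) * (r * b (i + 1) + q * c (i + 1)) := by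
      intro i hi
      have hi' := Finset.mem_range.mp hi
      rw [Derivation.leibniz, smul_eq_mul, smul_eq_mul, hD i hi']
      obtain ⟨k, hk⟩ : ∃ k, n - i = k + 1 := ⟨n - i - 1, by omega⟩
      rw [hk, hD k (by omega)]
    rw [map_sum, Finset.sum_congr rfl hs, Finset.sum_add_distrib,
      ← Finset.sum_range_reflect (fun i => a (n - i) * (r * b (i + 1) + q * c (i + 1))),
      ← Finset.sum_add_distrib]
    refine Finset.sum_congr rfl fun i hi => ?_
    have hi' := Finset.mem_range.mp hi
    rw [show n - (n - 1 - i) = i + 1 by omega, show n - 1 - i + 1 = n - i by omega]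
    ring
  rw [aknsDiagonal, Finset.sum_sub_distrib, map_sub, h2, ← h1]
  ring

end AKNS

/-! ### The kernel of the total derivative -/

theorem totalDeriv_X (v : Fin 2 × ℕ) :
    totalDeriv (MvPolynomial.X v) = MvPolynomial.X (v.1, v.2 + 1) := by
  simp [totalDeriv]

/-- The commutator `[∂/∂u_{j+1}, ∂ₓ] = ∂/∂u_j` relates two derivations, so it is enough to compare
them on the variables. -/
theorem pderiv_totalDeriv (i : Fin 2) (j : ℕ) (P : DiffPoly) :
    MvPolynomial.pderiv (i, j + 1) (totalDeriv P) =
      totalDeriv (MvPolynomial.pderiv (i, j + 1) P) + MvPolynomial.pderiv (i, j) P := by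
  have h : ⁅MvPolynomial.pderiv (R := ℂ) (i, j + 1), totalDeriv⁆ = MvPolynomial.pderiv (i, j) := by
    apply MvPolynomial.derivation_ext
    rintro ⟨i', j'⟩
    rw [Derivation.commutator_apply, totalDeriv_X]
    classical
    rw [MvPolynomial.pderiv_X, MvPolynomial.pderiv_X, MvPolynomial.pderiv_X]
    have : totalDeriv (Pi.single (M := fun _ => DiffPoly) (i, j + 1) 1 (i', j')) = 0 := by
      rw [Pi.single_apply]; split_ifs <;> simp
    rw [this, sub_zero, Pi.single_apply, Pi.single_apply]
    simp only [Prod.mk.injEq, add_left_inj]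
  rw [← h, Derivation.commutator_apply]
  abel

theorem eq_C_of_forall_pderiv_eq_zero {σ : Type*} {P : MvPolynomial σ ℂ}
    (h : ∀ i, MvPolynomial.pderiv i P = 0) : P = MvPolynomial.C (MvPolynomial.constantCoeff P) := by
  classical
  ext s
  rw [MvPolynomial.coeff_C]
  split_ifs with hs
  · rw [← hs]; rfl
  · obtain ⟨i, hi⟩ : ∃ i, s i ≠ 0 := by
      by_contra! hcon
      exact hs (Finsupp.ext fun i => (hcon i).symm)
    have h1 := congrArg (MvPolynomial.coeff (s - Finsupp.single i 1)) (h i)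
    rw [MvPolynomial.coeff_pderiv] at h1
    have h2 : s - Finsupp.single i 1 + Finsupp.single i 1 = s := by
      ext k
      by_cases hk : k = i
      · subst hk; simp; omega
      · simp [Ne.symm hk]
    rw [h2] at h1
    rw [MvPolynomial.coeff_zero] at h1
    rcases mul_eq_zero.mp h1 with h3 | h3
    · exact h3
    · exact absurd h3 (Nat.cast_add_one_ne_zero _)

/-- Partial derivatives of order beyond that of `P` vanish. When `totalDeriv P = 0`, the commutator
relation passes this vanishing from order `j + 1` to order `j`, down to order `0`. -/
theorem eq_C_of_totalDeriv_eq_zero {P : DiffPoly} (h : totalDeriv P = 0) :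
    P = MvPolynomial.C (MvPolynomial.constantCoeff P) := by
  obtain ⟨B, hB⟩ : ∃ B : ℕ, ∀ v ∈ P.vars, v.2 < B :=
    ⟨P.vars.sup Prod.snd + 1, fun v hv => Nat.lt_succ_of_le (Finset.le_sup (f := Prod.snd) hv)⟩
  have key : ∀ k j i, B ≤ j + k → MvPolynomial.pderiv (i, j) P = 0 := by
    intro k
    induction k with
    | zero =>
      intro j i hj
      exact MvPolynomial.pderiv_eq_zero_of_notMem_vars fun hv => by
        have := hB _ hv
        simp only at this
        omega
    | succ k ih =>
      intro j i hj
      have h1 := pderiv_totalDeriv i j P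
      rw [h, ih (j + 1) i (by omega)] at h1
      simpa using h1.symm
  exact eq_C_of_forall_pderiv_eq_zero fun v => key B v.2 v.1 (Nat.le_add_left _ _)

theorem constantCoeff_totalDeriv (P : DiffPoly) :
    MvPolynomial.constantCoeff (totalDeriv P) = 0 := by
  induction P using MvPolynomial.induction_on with
  | C a => simp [totalDeriv]
  | add p q hp hq => simp [hp, hq]
  | mul_X p v hp => simp [totalDeriv_X, hp]

theorem totalDeriv_injOn {P Q : DiffPoly} (h : totalDeriv P = totalDeriv Q)
    (hc : MvPolynomial.constantCoeff P = MvPolynomial.constantCoeff Q) : P = Q := by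
  have h1 := eq_C_of_totalDeriv_eq_zero (P := P - Q) (by rw [map_sub, h, sub_self])
  rw [map_sub, hc, sub_self, map_zero] at h1
  exact sub_eq_zero.mp h1

theorem totalDerivInv_eq {P Q : DiffPoly} (h : totalDeriv Q = P)
    (hc : MvPolynomial.constantCoeff Q = 0) : totalDerivInv P = Q := by
  have hex : ∃ Q : DiffPoly, totalDeriv Q = P ∧ MvPolynomial.constantCoeff Q = 0 := ⟨Q, h, hc⟩
  rw [totalDerivInv, dif_pos hex]
  have hs := Classical.choose_spec hex
  exact totalDeriv_injOn (hs.1.trans h.symm) (hs.2.trans hc.symm)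

/-! ### Locality of the AKNS hierarchy -/

/-- The first off-diagonal sequence of the AKNS resolvent. -/
def aknsB : ℕ → DiffPoly
  | 0 => 0
  | n + 1 => (aknsFlow n).1

/-- The second off-diagonal sequence of the AKNS resolvent. -/
def aknsC : ℕ → DiffPoly
  | 0 => 0
  | n + 1 => (aknsFlow n).2

/-- The diagonal sequence of the AKNS resolvent. -/
def aknsA : ℕ → DiffPoly
  -- With this value the first step of the recursion gives `b 1 = -q` and `c 1 = r`, the starting
  -- column.
  | 0 => MvPolynomial.C (-1 / 2)
  | n + 1 => totalDerivInv (aknsDensity (aknsFlow n))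

theorem two_mul_C_half : (2 : DiffPoly) * MvPolynomial.C (-1 / 2) = -1 := by
  rw [show (2 : DiffPoly) = MvPolynomial.C 2 from (map_ofNat MvPolynomial.C 2).symm,
    ← MvPolynomial.C_mul]
  norm_num

theorem isAKNSSequence_akns : IsAKNSSequence totalDeriv qVar rVar aknsA aknsB aknsC where
  b_zero := rfl
  c_zero := rfl
  b_succ n := by
    cases n with
    | zero =>
      simp only [aknsB, aknsA, aknsFlow, Function.iterate_zero, id, map_zero]
      linear_combination (-qVar) * two_mul_C_half
    | succ n => simp only [aknsB, aknsA, aknsFlow, Function.iterate_succ_apply', aknsRecursion]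
  c_succ n := by
    cases n with
    | zero =>
      simp only [aknsC, aknsA, aknsFlow, Function.iterate_zero, id, map_zero]
      linear_combination rVar * two_mul_C_half
    | succ n => simp only [aknsC, aknsA, aknsFlow, Function.iterate_succ_apply', aknsRecursion]

theorem constantCoeff_aknsB_aknsC (n : ℕ) :
    MvPolynomial.constantCoeff (aknsB n) = 0 ∧ MvPolynomial.constantCoeff (aknsC n) = 0 := by
  cases n with
  | zero => simp [aknsB, aknsC]
  | succ n =>
    rw [isAKNSSequence_akns.b_succ, isAKNSSequence_akns.c_succ]
    simp [constantCoeff_totalDeriv, qVar, rVar]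

/-- The three assertions need a joint strong induction: if the earlier diagonal entries are true
antiderivatives, the normalisation produces the next one with zero constant term. Hence
`totalDerivInv` selects it and never takes its default value `0`. -/
theorem aknsA_succ (n : ℕ) : aknsA (n + 1) = aknsDiagonal aknsA aknsB aknsC n ∧
    totalDeriv (aknsA (n + 1)) = rVar * aknsB (n + 1) + qVar * aknsC (n + 1) ∧
    MvPolynomial.constantCoeff (aknsA (n + 1)) = 0 := by
  induction n using Nat.strong_induction_on with
  | _ n ih =>
    have h1 := isAKNSSequence_akns.deriv_aknsDiagonal two_mul_C_half n fun i hi => (ih i hi).2.1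
    have h2 : MvPolynomial.constantCoeff (aknsDiagonal aknsA aknsB aknsC n) = 0 := by
      rw [aknsDiagonal, map_sum]
      refine Finset.sum_eq_zero fun i hi => ?_
      simp [(ih i (Finset.mem_range.mp hi)).2.2, constantCoeff_aknsB_aknsC]
    have h3 : aknsA (n + 1) = aknsDiagonal aknsA aknsB aknsC n := totalDerivInv_eq h1 h2
    exact ⟨h3, h3 ▸ h1, h3 ▸ h2⟩

/-- The densities of the AKNS recursion are total derivatives, in exactly one way. -/
theorem existsUnique_antiderivative (n : ℕ) : ∃! Q : DiffPoly,
    totalDeriv Q = aknsDensity (aknsFlow n) ∧ MvPolynomial.constantCoeff Q = 0 :=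
  ⟨aknsA (n + 1), (aknsA_succ n).2, fun _ hQ =>
    totalDeriv_injOn (hQ.1.trans (aknsA_succ n).2.1.symm) (hQ.2.trans (aknsA_succ n).2.2.symm)⟩

/-! ### The resolvent of a Schrödinger operator from a pair of wave functions -/

section Resolvent

variable {R₀ ℬ : Type*} [CommRing R₀] [CommRing ℬ] [Algebra R₀ ℬ] (δ : Derivation R₀ ℬ ℬ)
  {z r p p' : ℬ}

/-- The Wronskian `z (p₁' p₂ - p₁ p₂') + p₁ p₂` of a pair of reduced wave functions. -/
def waveWronskian (z p p' : ℬ) : ℬ := z * (δ p * p' - p * δ p') + p * p'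

/-- Formally, for invertible `z` and `k = 1/(2z)`, the functions `p e^{kx}` and `p' e^{-kx}` solve
the same equation `y'' = (r + k²) y`, and `waveWronskian` is `z` times their Wronskian. Here `p'` is
a second wave function, not a derivative. -/
theorem deriv_waveWronskian (hz : δ z = 0) (hp : z * δ (δ p) + δ p = z * r * p)
    (hp' : -(z * δ (δ p')) + δ p' = -(z * r * p')) : δ (waveWronskian δ z p p') = 0 := by
  simp only [waveWronskian, map_add, map_sub, Derivation.leibniz, smul_eq_mul, hz]
  linear_combination p' * hp + p * hp'

theorem deriv_eq_zero_of_mul_eq_one {θ θ' : ℬ} (h0 : δ θ = 0) (hθ : θ * θ' = 1) : δ θ' = 0 := by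
  have h2 := congrArg δ hθ
  rw [Derivation.leibniz, h0, smul_zero, add_zero, smul_eq_mul, Derivation.map_one_eq_zero] at h2
  linear_combination θ' * h2 - (δ θ') * hθ

/-- The classical quadratic expression in a product of two solutions of a Schrödinger equation
equals the square of their Wronskian; dividing by that square makes the right side `1`. -/
theorem resolvent_quadratic (hz : δ z = 0) (hp : z * δ (δ p) + δ p = z * r * p)
    (hp' : -(z * δ (δ p')) + δ p' = -(z * r * p')) {R θ' : ℬ}
    (hθ : waveWronskian δ z p p' * θ' = 1) (hR : R = p * p' * θ') :
    R ^ 2 + z ^ 2 * δ R ^ 2 - 2 * z ^ 2 * R * δ (δ R) + 4 * r * z ^ 2 * R ^ 2 = 1 := by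
  have h0 := deriv_waveWronskian δ hz hp hp'
  have h1 := deriv_eq_zero_of_mul_eq_one δ h0 hθ
  have hR1 : δ R = (δ p * p' + p * δ p') * θ' := by
    rw [hR]; simp only [Derivation.leibniz, smul_eq_mul, h1]; ring
  have hR2 : δ (δ R) = (δ (δ p) * p' + 2 * δ p * δ p' + p * δ (δ p')) * θ' := by
    rw [hR1]; simp only [Derivation.leibniz, map_add, smul_eq_mul, h1]; ring
  have hq : (p * p') ^ 2 + z ^ 2 * (δ p * p' + p * δ p') ^ 2 -
      2 * z ^ 2 * (p * p') * (δ (δ p) * p' + 2 * δ p * δ p' + p * δ (δ p')) +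
      4 * r * z ^ 2 * (p * p') ^ 2 = waveWronskian δ z p p' ^ 2 := by
    rw [waveWronskian]
    linear_combination (-2 * z * p * p' ^ 2) * hp + (2 * z * p ^ 2 * p') * hp'
  rw [hR2, hR1, hR]
  linear_combination θ' ^ 2 * hq + (waveWronskian δ z p p' * θ' + 1) * hθ

/-- The differential equation of third order for the resolvent. -/
theorem resolvent_linear (hz : δ z = 0) (hp : z * δ (δ p) + δ p = z * r * p)
    (hp' : -(z * δ (δ p')) + δ p' = -(z * r * p')) {R θ' : ℬ}
    (hθ : waveWronskian δ z p p' * θ' = 1) (hR : R = p * p' * θ') :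
    δ R = z ^ 2 * δ (δ (δ R)) - 2 * δ r * z ^ 2 * R - 4 * r * z ^ 2 * δ R := by
  have h0 := deriv_waveWronskian δ hz hp hp'
  have h1 := deriv_eq_zero_of_mul_eq_one δ h0 hθ
  have hR1 : δ R = (δ p * p' + p * δ p') * θ' := by
    rw [hR]; simp only [Derivation.leibniz, smul_eq_mul, h1]; ring
  have hR3 : δ (δ (δ R)) = (δ (δ (δ p)) * p' + 3 * δ (δ p) * δ p' + 3 * δ p * δ (δ p') +
      p * δ (δ (δ p'))) * θ' := by
    rw [hR1]; simp only [Derivation.leibniz, map_add, smul_eq_mul, h1, map_zero]; ring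
  have hp1 := congrArg δ hp
  have hp1' := congrArg δ hp'
  simp only [map_add, map_neg, Derivation.leibniz, smul_eq_mul, hz, mul_zero, add_zero] at hp1 hp1'
  rw [hR3, hR1, hR]
  linear_combination θ' * (p' * hp) + θ' * (p * hp') - θ' * z * (p' * hp1) + θ' * z * (p * hp1')
    - 3 * θ' * z * δ p' * hp + 3 * θ' * z * δ p * hp'

end Resolvent

/-! ### The companion matrix of a Wronskian system -/

section Companion

open PowerSeries

variable {𝒜 : Type*} [CommRing 𝒜] {m : ℕ}

/-- The linear combination `∑ᵢ yᵢ e (i + k)`. -/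
def shiftComb {ι : Type*} (e : ℕ → ι → 𝒜) (k : ℕ) (y : Fin (m + 1) → 𝒜) : ι → 𝒜 :=
  fun j => ∑ i, y i * e (i + k) j

/-- Multiplication by `∂` modulo `∂ᵐ⁺¹ - ∑ γᵢ ∂ⁱ` on the coefficients of an operator. -/
def companion (γ y : Fin (m + 1) → 𝒜) : Fin (m + 1) → 𝒜 :=
  fun i => (Fin.cons 0 (fun j : Fin m => y j.castSucc) : Fin (m + 1) → 𝒜) i + y (Fin.last m) * γ i

theorem shiftComb_companion {ι : Type*} {e : ℕ → ι → 𝒜} {γ : Fin (m + 1) → 𝒜}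
    (hγ : shiftComb e 0 γ = e (m + 1)) (y : Fin (m + 1) → 𝒜) :
    shiftComb e 1 y = shiftComb e 0 (companion γ y) := by
  ext j
  have h := congrFun hγ j
  simp only [shiftComb, companion, add_zero, add_mul, Finset.sum_add_distrib, mul_assoc,
    ← Finset.mul_sum] at h ⊢
  rw [h, Fin.sum_univ_castSucc, Fin.sum_univ_succ]
  simp

/-- The reversed symbol `∑ᵢ yᵢ (2z)^{m+1-i}` of an operator `∑ᵢ yᵢ ∂ⁱ`. -/
def revSymbol (y : Fin (m + 1) → 𝒜) : 𝒜⟦X⟧ := ∑ i, C (y i) * (2 * X) ^ (m + 1 - (i : ℕ))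

/-- In the reversed symbol `∂` stands for `1/(2z)`, up to the common factor `(2z)^{m+1}`. Replacing
`∂^{m+1}`, whose symbol is `1`, by `∑ γ_i ∂^i` costs the correction `y_m (1 - revSymbol γ)`. -/
theorem revSymbol_companion (γ y : Fin (m + 1) → 𝒜) :
    revSymbol y = 2 * X * (revSymbol (companion γ y) + C (y (Fin.last m)) * (1 - revSymbol γ)) := by
  have h : revSymbol (companion γ y) = revSymbol
      (Fin.cons 0 (fun j : Fin m => y j.castSucc) : Fin (m + 1) → 𝒜) +
      C (y (Fin.last m)) * revSymbol γ := by
    simp only [revSymbol, companion, map_add, map_mul, add_mul, Finset.sum_add_distrib,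
      Finset.mul_sum, mul_assoc]
  rw [h, revSymbol, Fin.sum_univ_castSucc, revSymbol, Fin.sum_univ_succ]
  simp only [Fin.cons_zero, Fin.cons_succ, map_zero, zero_mul, zero_add, Fin.val_castSucc,
    Fin.val_last, Fin.val_succ, Nat.add_sub_add_right]
  have h2 : ∀ i : Fin m, (2 * X : 𝒜⟦X⟧) ^ (m + 1 - (i : ℕ)) = 2 * X * (2 * X) ^ (m - (i : ℕ)) := by
    intro i
    rw [← pow_succ']
    congr 1
    omega
  simp only [h2, Nat.add_sub_cancel_left, pow_one]
  have h3 : ∑ i : Fin m, C (y i.castSucc) * (2 * X * (2 * X) ^ (m - (i : ℕ))) =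
      2 * X * ∑ i : Fin m, C (y i.castSucc) * (2 * X) ^ (m - (i : ℕ)) := by
    rw [Finset.mul_sum]
    exact Finset.sum_congr rfl fun i _ => by ring
  rw [h3]
  ring

theorem constantCoeff_revSymbol (y : Fin (m + 1) → 𝒜) : constantCoeff (revSymbol y) = 0 := by
  rw [revSymbol, map_sum]
  refine Finset.sum_eq_zero fun i _ => ?_
  simp [show m + 1 - (i : ℕ) ≠ 0 by omega]

theorem revSymbol_smul (x : 𝒜) (y : Fin (m + 1) → 𝒜) :
    revSymbol (fun i => x * y i) = C x * revSymbol y := by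
  simp only [revSymbol, map_mul, Finset.mul_sum, mul_assoc]

theorem revSymbol_add (y y' : Fin (m + 1) → 𝒜) :
    revSymbol (fun i => y i + y' i) = revSymbol y + revSymbol y' := by
  simp only [revSymbol, map_add, add_mul, Finset.sum_add_distrib]

/-- In the coefficient of `z^{n+1}` the constant drops out, and the two terms with `f_0 = -1/2`
isolate `f_{n+1}`. -/
theorem aknsDiagonal_of_quadratic {f g h : 𝒜⟦X⟧} {κ : 𝒜} (hg : coeff 0 g = 0) (hh : coeff 0 h = 0)
    (hf : 2 * coeff 0 f = -1) (hq : f * f - g * h = C κ) (n : ℕ) :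
    coeff (n + 1) f =
      aknsDiagonal (fun k => coeff k f) (fun k => coeff k g) (fun k => coeff k h) n := by
  have h1 := congrArg (coeff (n + 1)) hq
  have hsplit : ∀ u : ℕ → 𝒜, ∑ i ∈ Finset.range (n + 1).succ, u i =
      ∑ i ∈ Finset.range n, u (i + 1) + u 0 + u (n + 1) := fun u => by
    rw [Finset.sum_range_succ, Finset.sum_range_succ']
  rw [map_sub, coeff_mul, coeff_mul, Finset.Nat.sum_antidiagonal_eq_sum_range_succ_mk,
    Finset.Nat.sum_antidiagonal_eq_sum_range_succ_mk, hsplit, hsplit, coeff_C,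
    if_neg n.succ_ne_zero] at h1
  simp only [hg, hh, Nat.sub_zero, Nat.sub_self, mul_zero, zero_mul, add_zero,
    Nat.reduceSubDiff] at h1
  rw [aknsDiagonal, Finset.sum_sub_distrib]
  linear_combination -h1 + coeff (n + 1) f * hf

theorem coeff_two_mul_X_pow (x : 𝒜) (j k : ℕ) :
    coeff k (C x * (2 * X) ^ j) = if k = j then 2 ^ j * x else 0 := by
  rw [mul_pow, coeff_C_mul, show (2 : 𝒜⟦X⟧) = C 2 from (map_ofNat C 2).symm, ← map_pow,
    coeff_C_mul, coeff_X_pow]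
  split_ifs <;> ring

variable [Algebra ℂ 𝒜] (D : Derivation ℂ 𝒜 𝒜)

theorem deriv_shiftComb {ι : Type*} {e : ℕ → ι → 𝒜} (he : ∀ k j, D (e k j) = e (k + 1) j) (k : ℕ)
    (y : Fin (m + 1) → 𝒜) (j : ι) :
    D (shiftComb e k y j) = shiftComb e (k + 1) y j + shiftComb e k (fun i => D (y i)) j := by
  simp only [shiftComb, map_sum, Derivation.leibniz, smul_eq_mul, he, Finset.sum_add_distrib,
    add_assoc]
  congr 1
  exact Finset.sum_congr rfl fun i _ => mul_comm _ _

theorem deriv_companion (γ y : Fin (m + 1) → 𝒜) (i : Fin (m + 1)) :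
    D (companion γ y i) = companion γ (fun i => D (y i)) i + y (Fin.last m) * D (γ i) := by
  refine Fin.cases ?_ (fun i => ?_) i <;> simp [companion] <;> ring

/-- The second reduction is not just `companion` applied twice: the differentiated relation `e (m+2)
= ∑ γ_i e (i+1) + ∑ γ_i' e i` contributes the extra multiple of `γ'`. -/
theorem shiftComb_two {ι : Type*} {e : ℕ → ι → 𝒜} (he : ∀ k j, D (e k j) = e (k + 1) j)
    {γ : Fin (m + 1) → 𝒜} (hγ : shiftComb e 0 γ = e (m + 1)) (y : Fin (m + 1) → 𝒜) :
    shiftComb e 2 y =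
      shiftComb e 0 (fun i => companion γ (companion γ y) i + y (Fin.last m) * D (γ i)) := by
  ext j
  have h1 := deriv_shiftComb D he 1 y j
  rw [shiftComb_companion hγ, deriv_shiftComb D he, shiftComb_companion hγ,
    shiftComb_companion hγ] at h1
  have h2 : shiftComb e 0 (fun i => D (companion γ y i)) j =
      shiftComb e 0 (companion γ (fun i => D (y i))) j +
        shiftComb e 0 (fun i => y (Fin.last m) * D (γ i)) j := by
    simp only [shiftComb, deriv_companion, add_mul, Finset.sum_add_distrib]
  have h3 : shiftComb e 0 (fun i => companion γ (companion γ y) i + y (Fin.last m) * D (γ i)) j =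
      shiftComb e 0 (companion γ (companion γ y)) j +
        shiftComb e 0 (fun i => y (Fin.last m) * D (γ i)) j := by
    simp only [shiftComb, add_mul, Finset.sum_add_distrib]
  rw [h3]
  linear_combination h2 - h1

/-- If `e` satisfies a second-order equation, the companion coefficients satisfy
`γ'' + 2 Γ γ' = 0`. -/
theorem companion_deriv {ι : Type*} {e : ℕ → ι → 𝒜} (he : ∀ k j, D (e k j) = e (k + 1) j)
    {γ : Fin (m + 1) → 𝒜} (hγ : shiftComb e 0 γ = e (m + 1))
    (hinj : Function.Injective (shiftComb (m := m) e 0))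
    (hΛ : shiftComb e 2 γ = e (m + 3)) (i : Fin (m + 1)) :
    D (D (γ i)) + 2 * companion γ (fun i => D (γ i)) i = 0 := by
  have h1 : ∀ j, e (m + 2) j = shiftComb e 1 γ j + shiftComb e 0 (fun i => D (γ i)) j := by
    intro j
    rw [← deriv_shiftComb D he, hγ, he]
  have h2 : ∀ j, e (m + 3) j = shiftComb e 2 γ j + shiftComb e 1 (fun i => D (γ i)) j +
      (shiftComb e 1 (fun i => D (γ i)) j + shiftComb e 0 (fun i => D (D (γ i))) j) := by
    intro j
    rw [← deriv_shiftComb D he, ← deriv_shiftComb D he, ← map_add, ← h1, he]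
  -- The relation differentiated twice is compared with the relation shifted by two, `hΛ`. The terms
  -- `shiftComb e 2 γ` cancel, and what remains is a combination of `e 0, …, e m`, to which
  -- injectivity applies.
  have h3 : shiftComb e 0 (fun i => D (D (γ i)) + 2 * companion γ (fun i => D (γ i)) i) =
      shiftComb e 0 (0 : Fin (m + 1) → 𝒜) := by
    ext j
    have h4 := h2 j
    rw [hΛ, shiftComb_companion hγ] at h4
    have h5 : shiftComb e 0 (fun i => D (D (γ i)) + 2 * companion γ (fun i => D (γ i)) i) j =
        shiftComb e 0 (fun i => D (D (γ i))) j +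
          2 * shiftComb e 0 (companion γ (fun i => D (γ i))) j := by
      simp only [shiftComb, add_mul, Finset.sum_add_distrib, Finset.mul_sum, mul_assoc]
    have h6 : shiftComb e 0 (0 : Fin (m + 1) → 𝒜) j = 0 := by simp [shiftComb]
    rw [h5, h6]
    linear_combination -h4
  exact congrFun (hinj h3) i

theorem coeffDeriv_two_mul_X_pow (k : ℕ) : coeffDeriv D ((2 * X : 𝒜⟦X⟧) ^ k) = 0 := by
  rw [Derivation.leibniz_pow, Derivation.leibniz, coeffDeriv_X, two_mul]
  simp [← one_add_one_eq_two]

theorem coeffDeriv_revSymbol (y : Fin (m + 1) → 𝒜) :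
    coeffDeriv D (revSymbol y) = revSymbol fun i => D (y i) := by
  simp only [revSymbol, map_sum]
  refine Finset.sum_congr rfl fun i _ => ?_
  rw [Derivation.leibniz, coeffDeriv_two_mul_X_pow, coeffDeriv_C, smul_zero, zero_add, smul_eq_mul,
    mul_comm]

/-- The wave function equation `z π'' + π' = z r π` for `r = -2 γₘ'`. -/
theorem wave_equation {γ : Fin (m + 1) → 𝒜}
    (hγ : ∀ i, D (D (γ i)) + 2 * companion γ (fun i => D (γ i)) i = 0) :
    X * coeffDeriv D (coeffDeriv D (1 - revSymbol γ)) + coeffDeriv D (1 - revSymbol γ) =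
      X * C (-2 * D (γ (Fin.last m))) * (1 - revSymbol γ) := by
  have h1 := revSymbol_companion γ (fun i => D (γ i))
  have h2 : revSymbol (fun i => D (D (γ i))) +
      2 * revSymbol (companion γ (fun i => D (γ i))) = 0 := by
    have h3 : (2 : 𝒜⟦X⟧) = C 2 := (map_ofNat C 2).symm
    rw [h3, ← revSymbol_smul, ← revSymbol_add]
    simp only [hγ]
    simp [revSymbol]
  rw [map_sub, Derivation.map_one_eq_zero, coeffDeriv_revSymbol, zero_sub, map_neg,
    coeffDeriv_revSymbol, map_mul, map_neg, map_ofNat]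
  linear_combination -h1 - X * h2

theorem rescale_neg_one_coeffDeriv (f : 𝒜⟦X⟧) :
    rescale (-1 : 𝒜) (coeffDeriv D f) = coeffDeriv D (rescale (-1 : 𝒜) f) := by
  ext n
  rw [coeff_rescale, coeff_coeffDeriv, coeff_coeffDeriv, coeff_rescale]
  rcases neg_one_pow_eq_or 𝒜 n with h | h <;> simp [h]

/-- One step of the iteration uses `revSymbol_companion` twice. The purpose is an expansion of `γ'`
in which both sums are even in `z` and the remainder is divisible by `z^{2L+1}`; parity then
separates the two sums. -/
theorem revSymbol_iterate {γ : Fin (m + 1) → 𝒜} {y : ℕ → Fin (m + 1) → 𝒜}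
    (hy0 : ∀ i, y 0 i = D (γ i))
    (hy : ∀ l i, y (l + 1) i =
      companion γ (companion γ (y l)) i + y l (Fin.last m) * D (γ i)) (L : ℕ) :
    -(2 * X * coeffDeriv D (1 - revSymbol γ)) = (2 * X) ^ (2 * L + 1) * revSymbol (y L) +
      (∑ l ∈ Finset.range L, C (y l (Fin.last m)) * (2 * X) ^ (2 * l + 2)) *
        (2 * X * coeffDeriv D (1 - revSymbol γ) + (1 - revSymbol γ)) +
      2 * X * (∑ l ∈ Finset.range L, C (companion γ (y l) (Fin.last m)) * (2 * X) ^ (2 * l + 2)) *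
        (1 - revSymbol γ) := by
  have hγ : revSymbol (fun i => D (γ i)) = -coeffDeriv D (1 - revSymbol γ) := by
    rw [map_sub, Derivation.map_one_eq_zero, coeffDeriv_revSymbol]; ring
  induction L with
  | zero =>
    rw [funext hy0, hγ]
    simp
  | succ L ih =>
    have h1 := revSymbol_companion γ (y L)
    have h2 := revSymbol_companion γ (companion γ (y L))
    have h3 : revSymbol (y (L + 1)) = revSymbol (companion γ (companion γ (y L))) +
        C (y L (Fin.last m)) * revSymbol (fun i => D (γ i)) := by
      rw [funext (hy L), revSymbol_add, revSymbol_smul]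
    rw [hγ] at h3
    rw [Finset.sum_range_succ, Finset.sum_range_succ, ih, h3]
    linear_combination (2 * X) ^ (2 * L + 1) * h1 + (2 * X) ^ (2 * L + 2) * h2

theorem isAKNSSequence_of_series {q r : 𝒜} {f g h : 𝒜⟦X⟧}
    (hg : g = X * (-coeffDeriv D g + 2 * C q * f)) (hh : h = X * (coeffDeriv D h - 2 * C r * f)) :
    IsAKNSSequence D q r (fun k => coeff k f) (fun k => coeff k g) (fun k => coeff k h) where
  b_zero := by rw [hg]; simp
  c_zero := by rw [hh]; simp
  b_succ n := by
    conv_lhs => rw [hg]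
    rw [coeff_succ_X_mul, map_add, map_neg, coeff_coeffDeriv, mul_assoc, two_mul, map_add,
      coeff_C_mul]
    ring
  c_succ n := by
    conv_lhs => rw [hh]
    rw [coeff_succ_X_mul, map_sub, coeff_coeffDeriv, mul_assoc, two_mul, map_add, coeff_C_mul]
    ring

/-- The AKNS flows with `q = 1`, `r = -2 γₘ'`, in terms of the iterates `yₗ` of the operator
`Γ² + γ' ⊗ εₘ` on `γ'`. -/
theorem companion_aknsSequence {γ : Fin (m + 1) → 𝒜}
    (hγ : ∀ i, D (D (γ i)) + 2 * companion γ (fun i => D (γ i)) i = 0)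
    {y : ℕ → Fin (m + 1) → 𝒜} (hy0 : ∀ i, y 0 i = D (γ i))
    (hy : ∀ l i, y (l + 1) i =
      companion γ (companion γ (y l)) i + y l (Fin.last m) * D (γ i))
    {a b c : ℕ → 𝒜} (h : IsAKNSSequence D 1 (-2 * D (γ (Fin.last m))) a b c) (h0 : 2 * a 0 = -1)
    (ha : ∀ n, a (n + 1) = aknsDiagonal a b c n) (l : ℕ) :
    c (2 * l + 2) = -2 * 4 ^ l * D (y l (Fin.last m)) := by
  set r := -2 * D (γ (Fin.last m)) with hr
  set δ := coeffDeriv D with hδ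
  set ν := rescale (-1 : 𝒜) with hν
  -- With `k = 1/(2X)`, the operator `∂^{m+1} - ∑ γ_i ∂^i` sends `e^{kx}` to `k^{m+1} p e^{kx}`. The
  -- substitution `ν : X ↦ -X` replaces `k` by `-k` and so gives the second wave function.
  obtain ⟨p, hp⟩ : ∃ p, p = 1 - revSymbol γ := ⟨_, rfl⟩
  have hνX : ν X = -X := by simp [hν]
  have hνC : ∀ x : 𝒜, ν (C x) = C x := fun x => by
    ext n
    rw [hν, coeff_rescale, coeff_C]
    split_ifs with hn <;> simp [hn]
  have hν2 : ν 2 = 2 := map_ofNat ν 2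
  have hνν : ∀ f, ν (ν f) = f := fun f => by
    ext n
    rw [hν, coeff_rescale, coeff_rescale, ← mul_assoc, ← mul_pow]
    simp
  have hνδ : ∀ f, ν (δ f) = δ (ν f) := rescale_neg_one_coeffDeriv D
  have hδX : δ X = 0 := coeffDeriv_X D
  have w1 : X * δ (δ p) + δ p = X * C r * p := by
    rw [hp]; exact wave_equation D hγ
  have w2 : -(X * δ (δ (ν p))) + δ (ν p) = -(X * C r * ν p) := by
    have := congrArg ν w1
    rw [map_add, map_mul, map_mul, map_mul, hνX, hνC, hνδ, hνδ] at this
    linear_combination this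
  obtain ⟨θ, hθ⟩ : ∃ θ, θ = waveWronskian δ X p (ν p) := ⟨_, rfl⟩
  have hp0 : constantCoeff p = 1 := by
    rw [hp, map_sub, constantCoeff_revSymbol, map_one, sub_zero]
  have hνp0 : constantCoeff (ν p) = 1 := by
    rw [← coeff_zero_eq_constantCoeff_apply, hν, coeff_rescale, coeff_zero_eq_constantCoeff_apply,
      hp0]
    simp
  have hθ0 : constantCoeff θ = 1 := by
    rw [hθ, waveWronskian, map_add, map_mul, map_mul, hp0, hνp0]
    simp
  obtain ⟨θ', hθ'⟩ : ∃ θ', θ * θ' = 1 :=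
    IsUnit.exists_right_inv (isUnit_iff_constantCoeff.mpr (hθ0 ▸ isUnit_one))
  obtain ⟨R, hR⟩ : ∃ R, R = p * ν p * θ' := ⟨_, rfl⟩
  have hR0 : constantCoeff R = 1 := by
    have := congrArg constantCoeff hθ'
    rw [map_mul, hθ0, one_mul, map_one] at this
    rw [hR, map_mul, map_mul, hp0, hνp0, this]
    ring
  have hνθ : ν θ = θ := by
    rw [hθ, waveWronskian, map_add, map_mul, map_mul, map_sub, map_mul, map_mul, hνX, hνδ, hνδ,
      hνν]
    ring
  have hνR : ν R = R := by
    have h1 := congrArg ν hθ'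
    rw [map_mul, hνθ, map_one] at h1
    have h2 : ν θ' = θ' := by linear_combination θ' * h1 - ν θ' * hθ'
    rw [hR, map_mul, map_mul, hνν, h2]
    ring
  have hquad := resolvent_quadratic δ hδX w1 w2 (hθ ▸ hθ') hR
  have hlin := resolvent_linear δ hδX w1 w2 (hθ ▸ hθ') hR
  obtain ⟨κ, hκ⟩ : ∃ κ : 𝒜, 2 * κ = 1 :=
    ⟨algebraMap ℂ 𝒜 (1 / 2), by rw [← map_ofNat (algebraMap ℂ 𝒜) 2, ← map_mul]; norm_num⟩
  have hκC : (2 : 𝒜⟦X⟧) * C κ = 1 := by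
    rw [show (2 : 𝒜⟦X⟧) = C 2 from (map_ofNat C 2).symm, ← map_mul, hκ, map_one]
  have hδκ : δ (C κ) = 0 := by
    have h1 := deriv_eq_zero_of_mul_eq_one δ (θ := 2) ?_ hκC
    · exact h1
    · rw [← one_add_one_eq_two, map_add, Derivation.map_one_eq_zero, add_zero]
  -- Starting from `b = -XR`, the recursion for `b` with `q = 1` forces `f`, and `a' = r b + c`
  -- forces `k`. Here `κ` is `1/2`.
  set f := -C κ * (R + X * δ R) with hf
  set g := -(X * R) with hg
  set k := -C κ * (δ R + X * δ (δ R)) + C r * X * R with hk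
  have hfgk : f * f - g * k = C (κ * κ) := by
    rw [hf, hg, hk, show C (κ * κ) = C κ * C κ from map_mul _ _ _]
    linear_combination C κ * C κ * hquad - (X * R * (C r * X * R)) * (1 + 2 * C κ) * hκC +
      X * R * C κ * (δ R + X * δ (δ R)) * hκC
  have hgs : g = X * (-δ g + 2 * C 1 * f) := by
    simp only [hg, hf, map_neg, Derivation.leibniz, smul_eq_mul, hδX, map_one]
    linear_combination X * (R + X * δ R) * hκC
  have hks : k = X * (δ k - 2 * C r * f) := by
    simp only [hk, hf, map_neg, map_add, Derivation.leibniz, smul_eq_mul, hδX, hδκ, neg_mul]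
    linear_combination -C κ * hlin + (X * X * (δ (C r) * R + C r * δ R) - C r * X * R) * hκC
  have hseq := isAKNSSequence_of_series D hgs hks
  have hf0 : 2 * coeff 0 f = -1 := by
    rw [coeff_zero_eq_constantCoeff_apply, hf, map_mul, map_neg, map_add, map_mul, hR0,
      constantCoeff_C, constantCoeff_X]
    linear_combination -hκ
  have hdiag := aknsDiagonal_of_quadratic hseq.b_zero hseq.c_zero hf0 hfgk
  have hfin := (h.eq_of_eq hseq (by linear_combination κ * h0 - κ * hf0 - (a 0 - coeff 0 f) * hκ)
    ha hdiag (2 * l + 2)).2.2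
  have hodd : coeff (2 * l + 1) R = 0 := by
    have h1 := congrArg (coeff (2 * l + 1)) hνR
    rw [hν, coeff_rescale, Odd.neg_one_pow ⟨l, rfl⟩] at h1
    linear_combination -κ * h1 - coeff (2 * l + 1) R * hκ
  -- The expansion is multiplied by `ν p`, its image under `ν` by `p`, and the two are added. The
  -- even sum with `companion` cancels, leaving `p · ν p = θ (1 + η)` up to terms divisible by
  -- `X^{2l+3}`. So `R` agrees with `1 + η` to the order needed.
  have heven : coeff (2 * l + 2) R = 4 ^ (l + 1) * y l (Fin.last m) := by
    have e1 := revSymbol_iterate D hy0 hy (l + 1)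
    have hodd' : ∀ j, (-(2 * X) : 𝒜⟦X⟧) ^ (2 * j + 2) = (2 * X) ^ (2 * j + 2) := fun j =>
      Even.neg_pow ⟨j + 1, by ring⟩ _
    have e2 := congrArg ν e1
    simp only [← hδ, ← hp, map_add, map_neg, map_mul, map_pow, map_sum, hνX, hνC, hν2, hνδ,
      mul_neg, hodd'] at e1 e2
    set η := ∑ l ∈ Finset.range (l + 1), C (y l (Fin.last m)) * (2 * X) ^ (2 * l + 2) with hη
    have e3 : R = (1 + η) + X ^ (2 * l + 3) * (C κ * (2 ^ (2 * l + 3) * revSymbol (y (l + 1)) * ν p -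
        2 ^ (2 * l + 3) * ν (revSymbol (y (l + 1))) * p) * θ') := by
      rw [Odd.neg_pow ⟨l + 1, by ring⟩] at e2
      have e4 : (2 * X : 𝒜⟦X⟧) ^ (2 * (l + 1) + 1) = 2 ^ (2 * l + 3) * X ^ (2 * l + 3) := by
        rw [mul_pow]; ring
      rw [e4] at e1 e2
      have e5 : θ = X * (δ p * ν p - p * δ (ν p)) + p * ν p := hθ
      rw [hR]
      linear_combination C κ * θ' * ν p * e1 + C κ * θ' * p * e2 - (p * ν p * θ' - 1 - η) * hκC
        + 2 * C κ * (1 + η) * hθ' - 2 * C κ * (1 + η) * θ' * e5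
    rw [e3, map_add, coeff_X_pow_mul', if_neg (by omega), add_zero, map_add, coeff_one,
      if_neg (by omega), zero_add, hη, map_sum]
    simp only [coeff_two_mul_X_pow]
    rw [Finset.sum_eq_single l]
    · rw [if_pos rfl, show 2 * l + 2 = 2 * (l + 1) by ring, pow_mul]
      norm_num
    · intro j _ hj
      rw [if_neg (by omega)]
    · intro hl
      exact absurd (Finset.mem_range.mpr l.lt_succ_self) hl
  -- The coefficient of `X^{2l+2}` in `k` is `-κ (D R_{2l+2} + D² R_{2l+1}) + r R_{2l+1}`, and the
  -- odd coefficients of `R` vanish.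
  rw [hfin, hk, map_add, neg_mul, map_neg, coeff_C_mul, map_add, coeff_coeffDeriv, mul_assoc,
    coeff_C_mul, show 2 * l + 2 = (2 * l + 1) + 1 by ring, coeff_succ_X_mul, coeff_succ_X_mul,
    coeff_coeffDeriv, coeff_coeffDeriv, hodd, show 2 * l + 1 + 1 = 2 * l + 2 by ring, heven]
  have h4 : D ((4 : 𝒜) ^ (l + 1)) = 0 := by
    rw [← map_ofNat (algebraMap ℂ 𝒜) 4, ← map_pow, Derivation.map_algebraMap]
  rw [Derivation.leibniz, h4, map_zero, map_zero, smul_eq_mul, smul_zero]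
  linear_combination (-2 * 4 ^ l * D (y l (Fin.last m))) * hκ

end Companion

/-! ### The KdV flows of a Wronskian system in a differential algebra -/

section Flow

variable {𝒜 : Type*} [CommRing 𝒜] [Algebra ℂ 𝒜] (D : Derivation ℂ 𝒜 𝒜) {m : ℕ}

/-- Since `Λ` is linear over `𝒜` and sends `e k` to `e (k+2)`, it acts on coefficient vectors as
right multiplication by `∂²` reduced by `γ`. Thus the iterates `Λ^l` on `γ'` are those of the
companion iteration. The homomorphism `ev` carries the universal AKNS sequence into `𝒜`. -/
theorem kdv_flow_eq {ι : Type*} {e : ℕ → ι → 𝒜} (he : ∀ k j, D (e k j) = e (k + 1) j)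
    {Λ : (ι → 𝒜) →ₗ[𝒜] (ι → 𝒜)} (hΛ : ∀ k, Λ (e k) = e (k + 2))
    (hinj : Function.Injective (shiftComb (m := m) e 0))
    {γ : Fin (m + 1) → 𝒜} (hγ : shiftComb e 0 γ = e (m + 1)) {y : ℕ → Fin (m + 1) → 𝒜}
    (hy0 : ∀ i, y 0 i = D (γ i))
    (hy : ∀ l, shiftComb e 0 (y (l + 1)) = Λ (shiftComb e 0 (y l)))
    {ev : DiffPoly →ₐ[ℂ] 𝒜} (hev : ∀ P, ev (totalDeriv P) = D (ev P)) (hq : ev qVar = 1)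
    (hr : ev rVar = -2 * D (γ (Fin.last m))) (l : ℕ) :
    ev (aknsFlow (2 * l + 1)).2 = -2 * 4 ^ l * D (y l (Fin.last m)) := by
  have hΛc : ∀ w : Fin (m + 1) → 𝒜, Λ (shiftComb e 0 w) = shiftComb e 2 w := by
    intro w
    have h1 : ∀ k, shiftComb e k w = ∑ i, w i • e (i + k) := fun k => by
      ext j; simp [shiftComb]
    rw [h1, h1, map_sum]
    exact Finset.sum_congr rfl fun i _ => by rw [map_smul, hΛ, add_zero]
  have hγ' : ∀ i, D (D (γ i)) + 2 * companion γ (fun i => D (γ i)) i = 0 :=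
    companion_deriv D he hγ hinj (by rw [← hΛc, hγ, hΛ])
  have hy' : ∀ l i, y (l + 1) i =
      companion γ (companion γ (y l)) i + y l (Fin.last m) * D (γ i) := by
    intro l i
    have h1 : y (l + 1) =
        fun i => companion γ (companion γ (y l)) i + y l (Fin.last m) * D (γ i) := hinj (by
      rw [hy, hΛc]
      exact shiftComb_two D he hγ (y l))
    exact congrFun h1 i
  have hseq : IsAKNSSequence D 1 (-2 * D (γ (Fin.last m))) (fun n => ev (aknsA n))
      (fun n => ev (aknsB n)) (fun n => ev (aknsC n)) := by
    have h := isAKNSSequence_akns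
    refine ⟨by simp [h.b_zero], by simp [h.c_zero], fun n => ?_, fun n => ?_⟩
    · rw [h.b_succ, map_add, map_neg, map_mul, map_mul, hev, hq, map_ofNat]
    · rw [h.c_succ, map_sub, map_mul, map_mul, hev, hr, map_ofNat]
  refine companion_aknsSequence D hγ' hy0 hy' hseq ?_ (fun n => ?_) l
  · rw [← map_ofNat ev, ← map_mul]
    exact (congrArg ev two_mul_C_half).trans (by rw [map_neg, map_one])
  · simp only [(aknsA_succ n).1, aknsDiagonal, map_sum, map_sub, map_mul]

end Flow

/-! ### Taylor series of analytic functions -/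

section Taylor

open PowerSeries

/-- The Taylor series of `g` at `x`. -/
def taylorSeries (g : ℂ → ℂ) (x : ℂ) : ℂ⟦X⟧ :=
  PowerSeries.mk fun j => iteratedDeriv j g x / (Nat.factorial j : ℂ)

theorem taylorSeries_congr {g h : ℂ → ℂ} {x : ℂ} (hgh : g =ᶠ[𝓝 x] h) :
    taylorSeries g x = taylorSeries h x := by
  ext n
  simp only [taylorSeries, coeff_mk, hgh.iteratedDeriv_eq n]

theorem taylorSeries_add {g h : ℂ → ℂ} {x : ℂ} (hg : AnalyticAt ℂ g x) (hh : AnalyticAt ℂ h x) :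
    taylorSeries (fun z => g z + h z) x = taylorSeries g x + taylorSeries h x := by
  ext n
  simp only [taylorSeries, coeff_mk, map_add,
    iteratedDeriv_fun_add hg.contDiffAt hh.contDiffAt, add_div]

theorem taylorSeries_mul {g h : ℂ → ℂ} {x : ℂ} (hg : AnalyticAt ℂ g x) (hh : AnalyticAt ℂ h x) :
    taylorSeries (fun z => g z * h z) x = taylorSeries g x * taylorSeries h x := by
  ext n
  rw [coeff_mul, Finset.Nat.sum_antidiagonal_eq_sum_range_succ_mk]
  simp only [taylorSeries, coeff_mk, iteratedDeriv_fun_mul hg.contDiffAt hh.contDiffAt,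
    Finset.sum_div]
  refine Finset.sum_congr rfl fun i hi => ?_
  rw [Nat.cast_choose ℂ (Nat.lt_succ_iff.mp (Finset.mem_range.mp hi))]
  have h1 : (Nat.factorial n : ℂ) ≠ 0 := Nat.cast_ne_zero.mpr n.factorial_ne_zero
  field_simp

theorem taylorSeries_const (c x : ℂ) : taylorSeries (fun _ => c) x = C c := by
  ext n
  simp only [taylorSeries, coeff_mk, coeff_C, iteratedDeriv_const]
  split_ifs with h <;> simp [h]

theorem taylorSeries_sum {ι : Type*} (s : Finset ι) {g : ι → ℂ → ℂ} {x : ℂ}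
    (hg : ∀ i ∈ s, AnalyticAt ℂ (g i) x) :
    taylorSeries (fun z => ∑ i ∈ s, g i z) x = ∑ i ∈ s, taylorSeries (g i) x := by
  classical
  induction s using Finset.induction_on with
  | empty => simpa using taylorSeries_const 0 x
  | insert a s ha ih =>
    simp only [Finset.sum_insert ha]
    rw [taylorSeries_add (hg a (Finset.mem_insert_self a s))
      (Finset.analyticAt_fun_sum s fun i hi => hg i (Finset.mem_insert_of_mem hi)),
      ih fun i hi => hg i (Finset.mem_insert_of_mem hi)]

theorem derivative_taylorSeries (g : ℂ → ℂ) (x : ℂ) :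
    derivative ℂ (taylorSeries g x) = taylorSeries (deriv g) x := by
  ext n
  rw [coeff_derivative]
  simp only [taylorSeries, coeff_mk, iteratedDeriv_succ', Nat.factorial_succ]
  push_cast
  have h1 : (Nat.factorial n : ℂ) ≠ 0 := Nat.cast_ne_zero.mpr n.factorial_ne_zero
  have h2 : (n : ℂ) + 1 ≠ 0 := Nat.cast_add_one_ne_zero n
  field_simp

theorem constantCoeff_taylorSeries (g : ℂ → ℂ) (x : ℂ) :
    constantCoeff (taylorSeries g x) = g x := by
  rw [← coeff_zero_eq_constantCoeff_apply]
  simp [taylorSeries]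

theorem constantCoeff_iterate_derivative_taylorSeries (g : ℂ → ℂ) (x : ℂ) (n : ℕ) :
    constantCoeff ((derivative ℂ)^[n] (taylorSeries g x)) = iteratedDeriv n g x := by
  induction n generalizing g with
  | zero => simp [constantCoeff_taylorSeries]
  | succ n ih =>
    rw [Function.iterate_succ_apply, derivative_taylorSeries, ih, iteratedDeriv_succ']

end Taylor

/-! ### Solutions of linear systems depending analytically on a parameter -/

section Solve

variable {ι : Type*} [Fintype ι]

theorem analyticAt_mulVec {κ : Type*} {E : ℂ → Matrix κ ι ℂ} {v : ℂ → ι → ℂ} {s : ℂ}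
    (hE : ∀ i j, AnalyticAt ℂ (fun z => E z i j) s) (hv : ∀ i, AnalyticAt ℂ (fun z => v z i) s)
    (i : κ) : AnalyticAt ℂ (fun z => (E z *ᵥ v z) i) s := by
  simp only [Matrix.mulVec, dotProduct]
  exact Finset.analyticAt_fun_sum _ fun j _ => (hE i j).mul (hv j)

theorem hasDerivAt_mulVec {κ : Type*} {E : ℂ → Matrix κ ι ℂ} {E' : Matrix κ ι ℂ}
    {v : ℂ → ι → ℂ} {v' : ι → ℂ} {s : ℂ}
    (hE : ∀ i j, HasDerivAt (fun z => E z i j) (E' i j) s)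
    (hv : ∀ i, HasDerivAt (fun z => v z i) (v' i) s) (i : κ) :
    HasDerivAt (fun z => (E z *ᵥ v z) i) ((E' *ᵥ v s + E s *ᵥ v') i) s := by
  simp only [Pi.add_apply, Matrix.mulVec, dotProduct, ← Finset.sum_add_distrib]
  exact HasDerivAt.fun_sum fun j _ => (hE i j).mul (hv j)

variable [DecidableEq ι]

theorem analyticAt_det {E : ℂ → Matrix ι ι ℂ} {s : ℂ}
    (hE : ∀ i j, AnalyticAt ℂ (fun z => E z i j) s) : AnalyticAt ℂ (fun z => (E z).det) s := by
  simp only [Matrix.det_apply']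
  refine Finset.analyticAt_fun_sum _ fun σ _ => analyticAt_const.mul ?_
  exact Finset.analyticAt_fun_prod _ fun i _ => hE _ _

theorem analyticAt_inv_mulVec {E : ℂ → Matrix ι ι ℂ} {v : ℂ → ι → ℂ} {s : ℂ}
    (hE : ∀ i j, AnalyticAt ℂ (fun z => E z i j) s) (hv : ∀ i, AnalyticAt ℂ (fun z => v z i) s)
    (hdet : (E s).det ≠ 0) (i : ι) : AnalyticAt ℂ (fun z => ((E z)⁻¹ *ᵥ v z) i) s := by
  refine analyticAt_mulVec (fun i j => ?_) hv i
  simp only [Matrix.inv_def, Ring.inverse_eq_inv', Matrix.smul_apply, smul_eq_mul,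
    Matrix.adjugate_apply]
  refine ((analyticAt_det hE).inv hdet).mul (analyticAt_det fun a b => ?_)
  simp only [Matrix.updateRow_apply]
  split_ifs
  exacts [analyticAt_const, hE a b]

/-- Cramer's formula supplies differentiability of the solution `w`; its derivative then comes from
differentiating `E w = v`. -/
theorem hasDerivAt_inv_mulVec {E : ℂ → Matrix ι ι ℂ} {E' : Matrix ι ι ℂ}
    {v : ℂ → ι → ℂ} {v' : ι → ℂ} {s : ℂ} (hE : ∀ i j, AnalyticAt ℂ (fun z => E z i j) s)
    (hv : ∀ i, AnalyticAt ℂ (fun z => v z i) s)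
    (hE' : ∀ i j, HasDerivAt (fun z => E z i j) (E' i j) s)
    (hv' : ∀ i, HasDerivAt (fun z => v z i) (v' i) s) (hdet : (E s).det ≠ 0) (i : ι) :
    HasDerivAt (fun z => ((E z)⁻¹ *ᵥ v z) i)
      (((E s)⁻¹ *ᵥ (v' - E' *ᵥ ((E s)⁻¹ *ᵥ v s))) i) s := by
  have hw := fun i => (analyticAt_inv_mulVec hE hv hdet i).differentiableAt.hasDerivAt
  have hev : ∀ᶠ z in 𝓝 s, (E z).det ≠ 0 :=
    (analyticAt_det hE).continuousAt.eventually_ne hdet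
  have h1 := hasDerivAt_mulVec hE' hw
  have h2 : E' *ᵥ ((E s)⁻¹ *ᵥ v s) +
      E s *ᵥ (fun i => deriv (fun z => ((E z)⁻¹ *ᵥ v z) i) s) = v' := by
    ext i
    refine (h1 i).unique ((hv' i).congr_of_eventuallyEq ?_)
    filter_upwards [hev] with z hz
    rw [Matrix.mulVec_mulVec, Matrix.mul_nonsing_inv _ (isUnit_iff_ne_zero.mpr hz),
      Matrix.one_mulVec]
  have h3 : (fun i => deriv (fun z => ((E z)⁻¹ *ᵥ v z) i) s) =
      (E s)⁻¹ *ᵥ (v' - E' *ᵥ ((E s)⁻¹ *ᵥ v s)) := by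
    rw [← h2, add_sub_cancel_left, Matrix.mulVec_mulVec,
      Matrix.nonsing_inv_mul _ (isUnit_iff_ne_zero.mpr hdet), Matrix.one_mulVec]
  rw [← h3]
  exact hw i

end Solve

/-! ### Wronskian solutions of the KdV hierarchy -/

/-- The function `r` solves `∂ₓ²e = Λ e`, `∂_{t_{2l+1}} e = 4ˡ Λˡ ∂ₓ e`, with `e j = ∂ₓʲ e`, on a set
of times that is invariant under changes of a single time. -/
structure IsKdVWave {ι : Type*} [Fintype ι] [DecidableEq ι] (Λ : Matrix ι ι ℂ)
    (e : ℕ → Times → ι → ℂ) (dom : Set Times) : Prop where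
  update_mem : ∀ t ∈ dom, ∀ l s, Function.update t l s ∈ dom
  second : ∀ t ∈ dom, ∀ j, e (j + 2) t = Λ *ᵥ e j t
  hasDerivAt : ∀ t ∈ dom, ∀ l j i, HasDerivAt (fun s => e j (Function.update t l s) i)
    (((4 : ℂ) ^ l • (Λ ^ l *ᵥ e (j + 1) t)) i) (t l)

namespace IsKdVWave

variable {m : ℕ} {Λ : Matrix (Fin (m + 1)) (Fin (m + 1)) ℂ} {e : ℕ → Times → Fin (m + 1) → ℂ}
  {dom : Set Times}

/-- The matrix with columns `∂ₓᵏ e, …, ∂ₓᵏ⁺ᵐ e`. -/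
def waveMatrix (e : ℕ → Times → Fin (m + 1) → ℂ) (k : ℕ) (t : Times) :
    Matrix (Fin (m + 1)) (Fin (m + 1)) ℂ :=
  Matrix.of fun i j => e (j + k) t i

/-- The coefficients of `∂ₓᵐ⁺¹ e` in terms of the lower derivatives. -/
def waveCoeff (e : ℕ → Times → Fin (m + 1) → ℂ) (t : Times) : Fin (m + 1) → ℂ :=
  (waveMatrix e 0 t)⁻¹ *ᵥ e (m + 1) t

/-- The derivative of `waveCoeff` along `t_{2l+1}`, up to the factor `4ˡ`. -/
def waveFlow (Λ : Matrix (Fin (m + 1)) (Fin (m + 1)) ℂ) (e : ℕ → Times → Fin (m + 1) → ℂ) (l : ℕ)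
    (t : Times) : Fin (m + 1) → ℂ :=
  (waveMatrix e 0 t)⁻¹ *ᵥ (Λ ^ l *ᵥ (e (m + 2) t - waveMatrix e 1 t *ᵥ waveCoeff e t))

/-- The potential `-2 ∂ₓ γₘ`. -/
def wavePotential (Λ : Matrix (Fin (m + 1)) (Fin (m + 1)) ℂ) (e : ℕ → Times → Fin (m + 1) → ℂ)
    (t : Times) : ℂ :=
  -2 * waveFlow Λ e 0 t (Fin.last m)

variable (h : IsKdVWave Λ e dom)
include h

/-- The set of times is invariant under changes of one time, so each entry is an entire function of
that time. -/
theorem analyticAt {t : Times} (ht : t ∈ dom) (l j : ℕ) (i : Fin (m + 1)) (s : ℂ) :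
    AnalyticAt ℂ (fun s => e j (Function.update t l s) i) s := by
  have hd : Differentiable ℂ (fun s => e j (Function.update t l s) i) := by
    intro s
    have h1 := h.hasDerivAt _ (h.update_mem t ht l s) l j i
    simp only [Function.update_idem, Function.update_self] at h1
    exact h1.differentiableAt
  exact hd.analyticAt s

theorem hasDerivAt_waveMatrix {t : Times} (ht : t ∈ dom) (l k : ℕ) (i j : Fin (m + 1)) :
    HasDerivAt (fun s => waveMatrix e k (Function.update t l s) i j)
      (((4 : ℂ) ^ l • (Λ ^ l * waveMatrix e (k + 1) t)) i j) (t l) :=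
  h.hasDerivAt t ht l (j + k) i

theorem analyticAt_waveCoeff {t : Times} (ht : t ∈ dom) (hdet : (waveMatrix e 0 t).det ≠ 0) (l : ℕ)
    (i : Fin (m + 1)) : AnalyticAt ℂ (fun s => waveCoeff e (Function.update t l s) i) (t l) :=
  analyticAt_inv_mulVec (fun i j => h.analyticAt ht l _ i _) (fun i => h.analyticAt ht l _ i _)
    (by rwa [Function.update_eq_self]) i

theorem hasDerivAt_waveCoeff {t : Times} (ht : t ∈ dom) (hdet : (waveMatrix e 0 t).det ≠ 0) (l : ℕ)
    (i : Fin (m + 1)) : HasDerivAt (fun s => waveCoeff e (Function.update t l s) i)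
      (((4 : ℂ) ^ l • waveFlow Λ e l t) i) (t l) := by
  have h1 := hasDerivAt_inv_mulVec (fun i j => h.analyticAt ht l _ i (t l))
    (fun i => h.analyticAt ht l (m + 1) i (t l)) (fun i j => h.hasDerivAt_waveMatrix ht l 0 i j)
    (fun i => h.hasDerivAt t ht l (m + 1) i) (by rwa [Function.update_eq_self]) i
  refine h1.congr_deriv (congrFun ?_ i)
  rw [Function.update_eq_self, waveFlow, Matrix.smul_mulVec, ← Matrix.mulVec_mulVec, ← smul_sub,
    Matrix.mulVec_smul, ← Matrix.mulVec_sub]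
  rfl

theorem analyticAt_waveFlow {t : Times} (ht : t ∈ dom) (hdet : (waveMatrix e 0 t).det ≠ 0)
    (k l : ℕ) (i : Fin (m + 1)) :
    AnalyticAt ℂ (fun s => waveFlow Λ e k (Function.update t l s) i) (t l) := by
  refine analyticAt_inv_mulVec (fun i j => h.analyticAt ht l _ i _) (fun i => ?_)
    (by rwa [Function.update_eq_self]) i
  refine analyticAt_mulVec (E := fun _ => Λ ^ k) (fun _ _ => analyticAt_const) (fun i => ?_) i
  exact (h.analyticAt ht l _ i _).sub
    (analyticAt_mulVec (fun i j => h.analyticAt ht l _ i _) (h.analyticAt_waveCoeff ht hdet l) i)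

/-- Apart from the factor `4^l`, the derivative is symmetric in `k` and `l`. This is the equality of
mixed derivatives of `γ`, used below for the pairs `(0, l)` and `(l, 0)`. -/
theorem hasDerivAt_waveFlow {t : Times} (ht : t ∈ dom) (hdet : (waveMatrix e 0 t).det ≠ 0)
    (k l : ℕ) (i : Fin (m + 1)) :
    HasDerivAt (fun s => waveFlow Λ e k (Function.update t l s) i)
      (((4 : ℂ) ^ l • ((waveMatrix e 0 t)⁻¹ *ᵥ
        (Λ ^ (k + l) *ᵥ (e (m + 3) t - waveMatrix e 2 t *ᵥ waveCoeff e t) -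
          Λ ^ k *ᵥ (waveMatrix e 1 t *ᵥ waveFlow Λ e l t) -
          Λ ^ l *ᵥ (waveMatrix e 1 t *ᵥ waveFlow Λ e k t)))) i) (t l) := by
  have h0 : ∀ i, AnalyticAt ℂ (fun s => (e (m + 2) (Function.update t l s) -
      waveMatrix e 1 (Function.update t l s) *ᵥ waveCoeff e (Function.update t l s)) i) (t l) :=
    fun i => (h.analyticAt ht l _ i _).sub
      (analyticAt_mulVec (fun i j => h.analyticAt ht l _ i _) (h.analyticAt_waveCoeff ht hdet l) i)
  have h1 : ∀ i, HasDerivAt (fun s => (e (m + 2) (Function.update t l s) -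
      waveMatrix e 1 (Function.update t l s) *ᵥ waveCoeff e (Function.update t l s)) i)
      (((4 : ℂ) ^ l • (Λ ^ l *ᵥ e (m + 3) t) - (((4 : ℂ) ^ l • (Λ ^ l * waveMatrix e 2 t)) *ᵥ
        waveCoeff e t + waveMatrix e 1 t *ᵥ ((4 : ℂ) ^ l • waveFlow Λ e l t))) i) (t l) := by
    intro i
    have h2 := hasDerivAt_mulVec (fun i j => h.hasDerivAt_waveMatrix ht l 1 i j)
      (h.hasDerivAt_waveCoeff ht hdet l) i
    rw [Function.update_eq_self] at h2
    exact (h.hasDerivAt t ht l (m + 2) i).sub h2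
  have h2 := hasDerivAt_mulVec (E := fun _ => Λ ^ k) (E' := 0)
    (fun i j => hasDerivAt_const (t l) ((Λ ^ k) i j)) h1
  have h3 := hasDerivAt_inv_mulVec (E := fun s => waveMatrix e 0 (Function.update t l s))
    (fun i j => h.analyticAt ht l _ i (t l))
    (fun i => analyticAt_mulVec (E := fun _ => Λ ^ k) (fun _ _ => analyticAt_const) h0 i)
    (fun i j => h.hasDerivAt_waveMatrix ht l 0 i j) h2 (by rwa [Function.update_eq_self]) i
  refine h3.congr_deriv (congrFun ?_ i)
  have h4 : (waveMatrix e 0 t)⁻¹ *ᵥ (Λ ^ k *ᵥ (e (m + 2) t - waveMatrix e 1 t *ᵥ waveCoeff e t)) =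
    waveFlow Λ e k t := rfl
  rw [Function.update_eq_self, h4, ← Matrix.mulVec_smul]
  simp only [Matrix.zero_mulVec, zero_add, Matrix.mulVec_sub, Matrix.mulVec_add, Matrix.mulVec_smul,
    Matrix.smul_mulVec, ← Matrix.mulVec_mulVec, pow_add, smul_sub]
  abel

theorem eventually_det_ne_zero {t : Times} (ht : t ∈ dom) (hdet : (waveMatrix e 0 t).det ≠ 0)
    (l : ℕ) : ∀ᶠ s in 𝓝 (t l), (waveMatrix e 0 (Function.update t l s)).det ≠ 0 := by
  have hc := (analyticAt_det (E := fun s => waveMatrix e 0 (Function.update t l s))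
    fun i j => h.analyticAt ht l _ i (t l)).continuousAt
  exact hc.eventually_ne (by simpa only [Function.update_eq_self] using hdet)

omit h in
theorem shiftComb_eq_mulVec {𝒜 : Type*} [CommRing 𝒜] (e : ℕ → Fin (m + 1) → 𝒜) (k : ℕ) :
    shiftComb e k = fun y => (Matrix.of fun i j : Fin (m + 1) => e (j + k) i) *ᵥ y := by
  ext y i
  simp [shiftComb, Matrix.mulVec, dotProduct, mul_comm]

open PowerSeries in
/-- The potential of a Wronskian system solves the KdV hierarchy. -/
theorem solvesKdVHierarchy :
    SolvesKdVHierarchy {t | t ∈ dom ∧ (waveMatrix e 0 t).det ≠ 0} (wavePotential Λ e) := by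
  rintro t ⟨ht, hdet⟩
  have hana : ∀ l, AnalyticAt ℂ (fun x => wavePotential Λ e (Function.update t l x)) (t l) :=
    fun l => analyticAt_const.mul (h.analyticAt_waveFlow ht hdet 0 l _)
  refine ⟨hana 0, fun l => ?_⟩
  have hd := (h.hasDerivAt_waveFlow ht hdet 0 l (Fin.last m)).const_mul (-2)
  refine hd.congr_deriv ?_
  have hd0 := h.hasDerivAt_waveFlow ht hdet l 0 (Fin.last m)
  -- Everything is transferred to Taylor series in `x` at the given point, an algebra with
  -- derivation to which `kdv_flow_eq` applies. A nonzero Wronskian at the point becomes a unit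
  -- there, because its constant coefficient is nonzero.
  set T : (Times → ℂ) → ℂ⟦X⟧ := fun g => taylorSeries (fun x => g (Function.update t 0 x)) (t 0)
    with hT
  set D := derivative ℂ with hD
  set E : ℕ → Fin (m + 1) → ℂ⟦X⟧ := fun j i => T (fun t => e j t i) with hE
  set y : ℕ → Fin (m + 1) → ℂ⟦X⟧ := fun j i => T (fun t => waveFlow Λ e j t i) with hy
  set γ : Fin (m + 1) → ℂ⟦X⟧ := fun i => T (fun t => waveCoeff e t i) with hγ
  have hTc : ∀ g, constantCoeff (T g) = g t := fun g => by
    simp only [hT, constantCoeff_taylorSeries, Function.update_eq_self]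
  have hupd : ∀ x, Function.update t 0 x ∈ dom := h.update_mem t ht 0
  have hTmul : ∀ (M : Times → Matrix (Fin (m + 1)) (Fin (m + 1)) ℂ) (v : Times → Fin (m + 1) → ℂ),
      (∀ i j, AnalyticAt ℂ (fun x => M (Function.update t 0 x) i j) (t 0)) →
      (∀ i, AnalyticAt ℂ (fun x => v (Function.update t 0 x) i) (t 0)) → ∀ i,
      T (fun t => (M t *ᵥ v t) i) = ((Matrix.of fun i j => T fun t => M t i j) *ᵥ
        fun i => T fun t => v t i) i := by
    intro M v hM hv i
    simp only [hT, Matrix.mulVec, dotProduct]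
    rw [taylorSeries_sum _ (g := fun j x => M (Function.update t 0 x) i j *
      v (Function.update t 0 x) j) fun j _ => (hM i j).mul (hv j)]
    exact Finset.sum_congr rfl fun j _ => taylorSeries_mul (hM i j) (hv j)
  have hEa : ∀ k i, AnalyticAt ℂ (fun x => e k (Function.update t 0 x) i) (t 0) :=
    fun k i => h.analyticAt ht 0 k i _
  have he : ∀ k i, D (E k i) = E (k + 1) i := by
    intro k i
    rw [hD, hE]
    simp only [hT]
    rw [derivative_taylorSeries]
    congr 1
    ext x
    have h1 := h.hasDerivAt _ (hupd x) 0 k i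
    simp only [Function.update_idem, Function.update_self, pow_zero, one_smul,
      Matrix.one_mulVec] at h1
    exact h1.deriv
  have hdetE : IsUnit (Matrix.of fun i j : Fin (m + 1) => E (j + 0) i).det := by
    rw [isUnit_iff_constantCoeff, RingHom.map_det, isUnit_iff_ne_zero]
    convert hdet
    ext i j
    exact hTc fun t => e (j + 0) t i
  have hinj : Function.Injective (shiftComb (m := m) E 0) := by
    rw [shiftComb_eq_mulVec]
    exact Matrix.mulVec_injective_of_isUnit ((Matrix.isUnit_iff_isUnit_det _).mpr hdetE)
  have hev0 : ∀ᶠ x in 𝓝 (t 0), (waveMatrix e 0 (Function.update t 0 x)).det ≠ 0 :=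
    h.eventually_det_ne_zero ht hdet 0
  have hcomb : ∀ (v : Times → Fin (m + 1) → ℂ) (w : Times → Fin (m + 1) → ℂ),
      (∀ i, AnalyticAt ℂ (fun x => v (Function.update t 0 x) i) (t 0)) →
      (∀ s, (waveMatrix e 0 s).det ≠ 0 → waveMatrix e 0 s *ᵥ v s = w s) →
      shiftComb E 0 (fun i => T fun t => v t i) = fun i => T fun t => w t i := by
    intro v w hv hw
    rw [shiftComb_eq_mulVec]
    ext1 i
    have h1 := hTmul (waveMatrix e 0) v (fun i j => hEa _ i) hv i
    refine Eq.trans h1.symm ?_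
    refine taylorSeries_congr ?_
    filter_upwards [hev0] with x hx
    rw [hw _ hx]
  have hsolve : ∀ (s : Times) (w : Fin (m + 1) → ℂ), (waveMatrix e 0 s).det ≠ 0 →
      waveMatrix e 0 s *ᵥ ((waveMatrix e 0 s)⁻¹ *ᵥ w) = w := fun s w hs => by
    rw [Matrix.mulVec_mulVec, Matrix.mul_nonsing_inv _ (isUnit_iff_ne_zero.mpr hs),
      Matrix.one_mulVec]
  have hγE : shiftComb E 0 γ = E (m + 1) :=
    hcomb _ _ (h.analyticAt_waveCoeff ht hdet 0) fun s hs => hsolve s _ hs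
  have hya := fun k => h.analyticAt_waveFlow ht hdet k 0
  have hyE := fun k => hcomb (waveFlow Λ e k) _ (hya k) fun s hs => hsolve s _ hs
  have hy0 : ∀ i, y 0 i = D (γ i) := by
    intro i
    rw [hD, hγ]
    simp only [hT, hy]
    rw [derivative_taylorSeries]
    refine taylorSeries_congr ?_
    filter_upwards [hev0] with x hx
    have h1 := h.hasDerivAt_waveCoeff (hupd x) hx 0 i
    simp only [Function.update_idem, Function.update_self, pow_zero, one_smul] at h1
    exact h1.deriv.symm
  set Λ' : Matrix (Fin (m + 1)) (Fin (m + 1)) ℂ⟦X⟧ := Matrix.of fun i j => T fun _ => Λ i j with hΛ'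
  have hΛT : ∀ v : Times → Fin (m + 1) → ℂ,
      (∀ i, AnalyticAt ℂ (fun x => v (Function.update t 0 x) i) (t 0)) →
      (fun i => T fun t => (Λ *ᵥ v t) i) = Λ' *ᵥ fun i => T fun t => v t i := by
    intro v hv
    ext1 i
    exact hTmul (fun _ => Λ) v (fun _ _ => analyticAt_const) hv i
  have hΛE : ∀ k, Λ'.mulVecLin (E k) = E (k + 2) := by
    intro k
    rw [Matrix.mulVecLin_apply, hE, ← hΛT _ (hEa k)]
    ext1 i
    simp only [hT]
    congr 1
    ext x
    rw [h.second _ (hupd x)]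
  have hyΛ : ∀ k, shiftComb E 0 (y (k + 1)) = Λ'.mulVecLin (shiftComb E 0 (y k)) := by
    intro k
    rw [hyE k, hyE (k + 1), Matrix.mulVecLin_apply]
    refine Eq.trans ?_ (hΛT (fun t => Λ ^ k *ᵥ (e (m + 2) t - waveMatrix e 1 t *ᵥ waveCoeff e t)) ?_)
    · simp only [Matrix.mulVec_mulVec, pow_succ']
    · exact analyticAt_mulVec (E := fun _ => Λ ^ k) (fun _ _ => analyticAt_const) fun i =>
        (h.analyticAt ht 0 _ i _).sub (analyticAt_mulVec (fun i j => h.analyticAt ht 0 _ i _)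
          (h.analyticAt_waveCoeff ht hdet 0) i)
  set r := T (wavePotential Λ e) with hr
  -- The variable `q` goes to `1` and its derivatives to `0`, as the reduction requires.
  set ev : DiffPoly →ₐ[ℂ] ℂ⟦X⟧ := MvPolynomial.aeval fun v : Fin 2 × ℕ =>
    if v.1 = 0 then (if v.2 = 0 then 1 else 0) else D^[v.2] r with hev
  have hrγ : r = -2 * D (γ (Fin.last m)) := by
    rw [← hy0, hr]
    simp only [hT, hy, wavePotential]
    rw [taylorSeries_mul analyticAt_const (hya 0 _), taylorSeries_const, map_neg, map_ofNat]
  have hevD : ∀ P, ev (totalDeriv P) = D (ev P) := by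
    intro P
    induction P using MvPolynomial.induction_on with
    | C a =>
      rw [← MvPolynomial.algebraMap_eq, Derivation.map_algebraMap, AlgHom.commutes, map_zero,
        Derivation.map_algebraMap]
    | add p q hp hq => simp only [map_add, hp, hq]
    | mul_X p v hp =>
      rw [Derivation.leibniz, map_mul, Derivation.leibniz, map_add, smul_eq_mul, smul_eq_mul,
        map_mul, map_mul, hp, totalDeriv_X, smul_eq_mul, smul_eq_mul]
      have hX : ev (MvPolynomial.X (v.1, v.2 + 1)) = D (ev (MvPolynomial.X v)) := by
        simp only [hev, MvPolynomial.aeval_X, Function.iterate_succ_apply']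
        split_ifs with h1 h2 h3 <;> simp_all
      rw [hX]
  have hmain := kdv_flow_eq D he hΛE hinj hγE hy0 hyΛ hevD
    (by simp [hev, qVar]) (by simp [hev, rVar, hrγ]) l
  have hfin : evalDiffPoly (aknsFlow (2 * l + 1)).2 (fun _ => 1) (wavePotential Λ e) t =
      constantCoeff (ev (aknsFlow (2 * l + 1)).2) := by
    have h1 : (constantCoeff (R := ℂ)).comp ev.toRingHom = MvPolynomial.eval fun v : Fin 2 × ℕ =>
        if v.1 = 0 then xDeriv (fun _ => (1 : ℂ)) v.2 t
        else xDeriv (wavePotential Λ e) v.2 t := by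
      refine MvPolynomial.ringHom_ext (fun a => ?_) fun v => ?_
      · rw [MvPolynomial.eval_C, RingHom.comp_apply]
        exact (congrArg constantCoeff (MvPolynomial.aeval_C _ a)).trans (constantCoeff_C a)
      · rw [MvPolynomial.eval_X, RingHom.comp_apply]
        refine (congrArg constantCoeff (MvPolynomial.aeval_X _ v)).trans ?_
        split_ifs with h1 h2
        · simp [xDeriv, h2]
        · simp [xDeriv, iteratedDeriv_const, h2]
        · exact constantCoeff_iterate_derivative_taylorSeries _ _ _
    rw [evalDiffPoly, ← h1]
    rfl
  have hDy : constantCoeff (D (y l (Fin.last m))) =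
      deriv (fun x => waveFlow Λ e l (Function.update t 0 x) (Fin.last m)) (t 0) := by
    rw [hD, hy]
    simp only [hT]
    rw [derivative_taylorSeries, constantCoeff_taylorSeries]
  rw [hfin, hmain, map_mul, map_mul, map_neg, map_pow, map_ofNat, map_ofNat, hDy, hd0.deriv]
  simp only [Pi.smul_apply, smul_eq_mul, zero_add, add_zero, pow_zero, one_mul, Matrix.one_mulVec]
  -- The derivative of `y_0` along `t_{2l+1}` and that of `y_l` along `x` differ, up to `4^l`, only
  -- in the order of the two mixed terms.
  rw [sub_right_comm]
  ring

end IsKdVWave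

/-! ### Exponentials of intertwined matrices -/

section Intertwine

variable {ι κ : Type*} [Fintype ι] [Fintype κ]

/-- `S` may be rectangular, so that the same argument covers the similarity `P`, the exchange `T`
from `A` to `-A`, and the selection of a block of rows. -/
theorem HasSum.matrix_intertwine {α : Type*} {S : Matrix κ ι ℂ} {f : α → Matrix ι ι ℂ}
    {g : α → Matrix κ κ ℂ} {a : Matrix ι ι ℂ} {b : Matrix κ κ ℂ} (hf : HasSum f a)
    (hg : HasSum g b) (h : ∀ j, S * f j = g j * S) : S * a = b * S := by
  have h1 := hf.map (Matrix.addMonoidHomMulLeft S) (continuous_const.matrix_mul continuous_id)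
  have h2 := hg.map (Matrix.addMonoidHomMulRight S) (continuous_id.matrix_mul continuous_const)
  refine h1.unique ?_
  convert! h2 using 1
  exact funext h

variable [DecidableEq ι] [DecidableEq κ]

theorem pow_intertwine {S : Matrix κ ι ℂ} {M : Matrix ι ι ℂ} {M' : Matrix κ κ ℂ}
    (h : S * M = M' * S) (n : ℕ) : S * M ^ n = M' ^ n * S := by
  induction n with
  | zero => simp
  | succ n ih => rw [pow_succ, ← Matrix.mul_assoc, ih, Matrix.mul_assoc, h, ← Matrix.mul_assoc,
      ← pow_succ]

theorem hasSum_exp (M : Matrix ι ι ℂ) :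
    HasSum (fun n : ℕ => ((Nat.factorial n : ℂ)⁻¹) • M ^ n) (NormedSpace.exp M) := by
  open scoped Matrix.Norms.Operator in
  exact NormedSpace.exp_series_hasSum_exp' (𝕂 := ℂ) M

theorem exp_intertwine {S : Matrix κ ι ℂ} {M : Matrix ι ι ℂ} {M' : Matrix κ κ ℂ}
    (h : S * M = M' * S) : S * NormedSpace.exp M = NormedSpace.exp M' * S :=
  (hasSum_exp M).matrix_intertwine (hasSum_exp M') fun n => by
    rw [Matrix.mul_smul, pow_intertwine h, Matrix.smul_mul]

theorem hasDerivAt_exp_add_smul (M N : Matrix ι ι ℂ) (h : Commute M N) (C : ι → ℂ) (a : ℂ) (i : ι) :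
    HasDerivAt (fun s : ℂ => (NormedSpace.exp (M + (s - a) • N) *ᵥ C) i)
      ((N *ᵥ (NormedSpace.exp M *ᵥ C)) i) a := by
  have h1 : ∀ s : ℂ, NormedSpace.exp (M + (s - a) • N) =
      NormedSpace.exp ((s - a) • N) * NormedSpace.exp M := fun s => by
    rw [add_comm, Matrix.exp_add_of_commute _ _ (h.symm.smul_left _)]
  have h2 : ∀ j, HasDerivAt (fun s : ℂ => NormedSpace.exp ((s - a) • N) i j) (N i j) a := by
    intro j
    open scoped Matrix.Norms.Operator in
    have h3 : HasDerivAt (fun s : ℂ => NormedSpace.exp ((s - a) • N)) N a := by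
      have h4 := hasDerivAt_exp_smul_const N (0 : ℂ)
      rw [zero_smul, NormedSpace.exp_zero, one_mul, ← sub_self a] at h4
      exact h4.comp_sub_const a a
    open scoped Matrix.Norms.Operator in
    exact ((Matrix.entryLinearMap ℂ ℂ i j).toContinuousLinearMap.hasFDerivAt.comp_hasDerivAt a h3)
  simp only [h1, ← Matrix.mulVec_mulVec]
  simp only [Matrix.mulVec, dotProduct]
  exact HasDerivAt.fun_sum fun j _ => (h2 j).mul_const _

end Intertwine

/-! ### Linear flows of the odd times -/

/-- The flow `∂_{t_{2l+1}} F = 4ˡ B^{2l+1} F` on a set of times invariant under changes of a single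
time. -/
structure IsLinearFlow {ι : Type*} [Fintype ι] [DecidableEq ι] (B : Matrix ι ι ℂ)
    (dom : Set Times) (F : Times → ι → ℂ) : Prop where
  update_mem : ∀ t ∈ dom, ∀ l s, Function.update t l s ∈ dom
  hasDerivAt : ∀ t ∈ dom, ∀ l i, HasDerivAt (fun s => F (Function.update t l s) i)
    (((4 : ℂ) ^ l • (B ^ (2 * l + 1) *ᵥ F t)) i) (t l)

theorem IsLinearFlow.congr {ι : Type*} [Fintype ι] [DecidableEq ι] {B : Matrix ι ι ℂ}
    {dom dom' : Set Times} {F G : Times → ι → ℂ} (h : IsLinearFlow B dom F) (hsub : dom' ⊆ dom)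
    (hmem : ∀ t ∈ dom', ∀ l s, Function.update t l s ∈ dom') (hFG : ∀ t ∈ dom', G t = F t) :
    IsLinearFlow B dom' G where
  update_mem := hmem
  hasDerivAt t ht l i := by
    rw [hFG t ht]
    have h1 : (fun s => G (Function.update t l s) i) = fun s => F (Function.update t l s) i :=
      funext fun s => by rw [hFG _ (hmem t ht l s)]
    rw [h1]
    exact h.hasDerivAt t (hsub ht) l i

theorem IsLinearFlow.intertwine {ι κ : Type*} [Fintype ι] [DecidableEq ι] [Fintype κ]
    [DecidableEq κ] {B : Matrix ι ι ℂ} {B' : Matrix κ κ ℂ} {S : Matrix κ ι ℂ} {dom : Set Times}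
    {F : Times → ι → ℂ} (h : IsLinearFlow B dom F) (hS : S * B = B' * S) :
    IsLinearFlow B' dom fun t => S *ᵥ F t where
  update_mem := h.update_mem
  hasDerivAt t ht l i := by
    have h1 := hasDerivAt_mulVec (E := fun _ => S) (E' := 0) (fun i j => hasDerivAt_const _ _)
      (h.hasDerivAt t ht l) i
    refine h1.congr_deriv ?_
    rw [Matrix.zero_mulVec, zero_add, Matrix.mulVec_smul, Matrix.mulVec_mulVec, pow_intertwine hS,
      Matrix.mulVec_mulVec]

theorem IsLinearFlow.xDeriv_eq {N : ℕ} {B : Matrix (Fin N) (Fin N) ℂ} {dom : Set Times}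
    {F : Times → Fin N → ℂ} (h : IsLinearFlow B dom F) {t : Times} (ht : t ∈ dom) (i : ℕ) :
    xDeriv F i t = B ^ i *ᵥ F t := by
  have key : iteratedDeriv i (fun x : ℂ => F (Function.update t 0 x)) =
      fun x => B ^ i *ᵥ F (Function.update t 0 x) := by
    induction i with
    | zero => simp
    | succ i ih =>
      rw [iteratedDeriv_succ, ih]
      ext1 x
      refine HasDerivAt.deriv (hasDerivAt_pi.mpr fun k => ?_)
      have h1 := h.hasDerivAt _ (h.update_mem t ht 0 x) 0
      simp only [Function.update_idem, Function.update_self, pow_zero, one_smul, mul_zero,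
        zero_add, pow_one] at h1
      have h2 := hasDerivAt_mulVec (E := fun _ => B ^ i) (E' := 0)
        (fun i j => hasDerivAt_const _ _) h1 k
      rwa [Matrix.zero_mulVec, zero_add, Matrix.mulVec_mulVec, ← pow_succ] at h2
  rw [xDeriv, key]
  beta_reduce
  rw [Function.update_eq_self]

section Exponential

variable {N : ℕ}

/-- Changing one time alters one term, so convergence persists and the sum is affine in that time.
-/
theorem hasSum_update_time {E : Type*} [AddCommGroup E] [Module ℂ E] [TopologicalSpace E]
    [IsTopologicalAddGroup E] {v : ℕ → E} {t : Times} (h : Summable fun j => t j • v j) (l : ℕ)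
    (s : ℂ) : HasSum (fun j => Function.update t l s j • v j)
      ((∑' j, t j • v j) + (s - t l) • v l) := by
  have h1 := h.hasSum.update l (s • v l)
  convert! h1 using 1
  · ext j
    by_cases hj : j = l
    · subst hj; simp
    · simp [Function.update_of_ne hj]
  · rw [sub_smul]; abel

theorem update_mem_seriesDomain {A : Matrix (Fin N) (Fin N) ℂ} {t : Times}
    (ht : t ∈ seriesDomain A) (l : ℕ) (s : ℂ) : Function.update t l s ∈ seriesDomain A :=
  (hasSum_update_time (v := fun j => A ^ (2 * j + 1)) ht l s).summable

theorem isLinearFlow_phiVec (A : Matrix (Fin N) (Fin N) ℂ) (C : Fin N → ℂ) :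
    IsLinearFlow ((1 / 2 : ℂ) • A) (seriesDomain A) (phiVec A C) where
  update_mem _ ht := update_mem_seriesDomain ht
  hasDerivAt t ht l i := by
    have h1 : ∀ s, (1 / 2 : ℂ) • ∑' j : ℕ, Function.update t l s j • A ^ (2 * j + 1) =
        (1 / 2 : ℂ) • ∑' j : ℕ, t j • A ^ (2 * j + 1) +
          (s - t l) • ((1 / 2 : ℂ) • A ^ (2 * l + 1)) := fun s => by
      rw [(hasSum_update_time (v := fun j => A ^ (2 * j + 1)) ht l s).tsum_eq, smul_add,
        smul_comm (1 / 2 : ℂ)]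
    simp only [phiVec, h1]
    have hc : Commute (∑' j : ℕ, t j • A ^ (2 * j + 1)) (A ^ (2 * l + 1)) :=
      (Commute.tsum_right _ fun j => ((Commute.refl A).pow_pow _ _).smul_right _).symm
    refine (hasDerivAt_exp_add_smul _ _ ((hc.smul_left _).smul_right _) C (t l) i).congr_deriv ?_
    rw [smul_pow, Matrix.smul_mulVec, Matrix.smul_mulVec, smul_smul]
    -- The factor `4^l` in `IsLinearFlow` compensates for halving the matrix: `4^l (A/2)^{2l+1} = ½
    -- A^{2l+1}`.
    have h2 : (4 : ℂ) ^ l * (1 / 2) ^ (2 * l + 1) = 1 / 2 := by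
      rw [pow_succ (1 / 2 : ℂ), pow_mul (1 / 2 : ℂ), ← mul_assoc, ← mul_pow]
      norm_num
    rw [h2]

theorem seriesDomain_neg (A : Matrix (Fin N) (Fin N) ℂ) : seriesDomain (-A) = seriesDomain A := by
  ext t
  simp only [seriesDomain, Set.mem_ofPred_eq, (odd_two_mul_add_one _).neg_pow, smul_neg]
  exact summable_neg_iff

theorem psiVec_eq (A : Matrix (Fin N) (Fin N) ℂ) (C : Fin N → ℂ) : psiVec A C = phiVec (-A) C := by
  ext1 t
  simp only [psiVec, phiVec, (odd_two_mul_add_one _).neg_pow, smul_neg, tsum_neg]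

theorem phiVec_intertwine {M : ℕ} {S : Matrix (Fin M) (Fin N) ℂ} {A : Matrix (Fin N) (Fin N) ℂ}
    {A' : Matrix (Fin M) (Fin M) ℂ} (h : S * A = A' * S) {t : Times} (ht : t ∈ seriesDomain A)
    (ht' : t ∈ seriesDomain A') (C : Fin N → ℂ) :
    S *ᵥ phiVec A C t = phiVec A' (S *ᵥ C) t := by
  have h1 : S * ∑' j : ℕ, t j • A ^ (2 * j + 1) = (∑' j : ℕ, t j • A' ^ (2 * j + 1)) * S :=
    HasSum.matrix_intertwine (Summable.hasSum ht) (Summable.hasSum ht') fun j => by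
      rw [Matrix.mul_smul, pow_intertwine h, Matrix.smul_mul]
  rw [phiVec, phiVec, Matrix.mulVec_mulVec, Matrix.mulVec_mulVec, exp_intertwine]
  rw [Matrix.mul_smul, h1, Matrix.smul_mul]

end Exponential

/-! ### Double Wronskians -/

section DoubleWronskian

variable {m : ℕ} {φ ψ : Times → Fin (2 * m + 3) → ℂ} {t : Times}

theorem doubleWronskian_mulVec {N : ℕ} {φ ψ φ' ψ' : Times → Fin N → ℂ} {t : Times}
    {P : Matrix (Fin N) (Fin N) ℂ} (hφ : ∀ i, xDeriv φ' i t = P *ᵥ xDeriv φ i t)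
    (hψ : ∀ i, xDeriv ψ' i t = P *ᵥ xDeriv ψ i t) (p : ℕ) :
    doubleWronskian p φ' ψ' t = P.det * doubleWronskian p φ ψ t := by
  rw [doubleWronskian, doubleWronskian, ← Matrix.det_mul]
  congr 1
  ext i j
  rw [Matrix.mul_apply]
  simp only [Matrix.of_apply]
  split_ifs
  · rw [hφ]; rfl
  · rw [hψ]; rfl

theorem finRotate_pow_val (n k : ℕ) (j : Fin (n + 1)) :
    ((((finRotate (n + 1)) ^ k) j : Fin (n + 1)) : ℕ) = ((j : ℕ) + k) % (n + 1) := by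
  induction k with
  | zero => simp [Nat.mod_eq_of_lt j.isLt]
  | succ k ih =>
    rw [pow_succ', Equiv.Perm.mul_apply, finRotate_apply, Fin.val_add, ih, Fin.val_one',
      ← Nat.add_mod, add_assoc]

/-- Exchanging the two halves of a double Wronskian. -/
theorem tauH_eq {T : Matrix (Fin (2 * m + 3)) (Fin (2 * m + 3)) ℂ}
    (hφ : ∀ i, xDeriv ψ i t = T *ᵥ xDeriv φ i t) (hψ : ∀ i, xDeriv φ i t = T *ᵥ xDeriv ψ i t) :
    tauH m φ ψ t = T.det * tauF m φ ψ t := by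
  -- Multiplying the columns of `f` by `T` interchanges `φ` and `ψ`; the result has the columns of
  -- `h`, rotated cyclically.
  rw [tauF, ← doubleWronskian_mulVec hφ hψ, tauH, doubleWronskian, doubleWronskian]
  -- The number `2m+3` of columns is odd, so a rotation is an even permutation and no sign appears.
  have hs : Equiv.Perm.sign ((finRotate (2 * m + 2 + 1)) ^ (m + 1)) = 1 := by
    rw [map_pow, sign_finRotate, Even.neg_one_pow ⟨m + 1, by omega⟩, one_pow]
  rw [← mul_one (Matrix.det _), ← Int.cast_one, ← Units.val_one (α := ℤ), ← hs, mul_comm,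
    ← Matrix.det_permute']
  congr 1
  ext i j
  have hv := finRotate_pow_val (2 * m + 2) (m + 1) j
  have hj := j.isLt
  simp only [Matrix.of_apply, Matrix.submatrix_apply, id]
  by_cases h1 : (j : ℕ) < m + 2
  · rw [Nat.mod_eq_of_lt (by omega)] at hv
    rw [if_pos h1, hv, if_neg (by omega), Nat.add_sub_cancel]
  · rw [Nat.mod_eq_sub_mod (by omega), Nat.mod_eq_of_lt (by omega)] at hv
    rw [if_neg h1, hv, if_pos (by omega),
      show (j : ℕ) + (m + 1) - (2 * m + 2 + 1) = j - (m + 2) by omega]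

/-- A linear combination of the columns of `tauF`. -/
theorem sum_columns (X Y a b : ℕ → ℂ) :
    ∑ j : Fin (2 * m + 3), (if (j : ℕ) < m + 2 then X j else Y (j - (m + 2))) *
      (if (j : ℕ) < m + 2 then a j else b (j - (m + 2))) =
      ∑ i ∈ Finset.range (m + 2), X i * a i + ∑ i ∈ Finset.range (m + 1), Y i * b i := by
  rw [Fin.sum_univ_eq_sum_range (fun j => (if j < m + 2 then X j else Y (j - (m + 2))) *
    (if j < m + 2 then a j else b (j - (m + 2)))) (2 * m + 3),
    show 2 * m + 3 = (m + 2) + (m + 1) by ring, Finset.sum_range_add]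
  congr 1
  · refine Finset.sum_congr rfl fun i hi => ?_
    rw [if_pos (Finset.mem_range.mp hi), if_pos (Finset.mem_range.mp hi)]
  · refine Finset.sum_congr rfl fun i _ => ?_
    rw [if_neg (by omega), if_neg (by omega), Nat.add_sub_cancel_left]

/-- If a nontrivial combination of the columns vanishes, so does `tauF`. -/
theorem tauF_eq_zero {a b : ℕ → ℂ} (hab : ∃ i < m + 2, a i ≠ 0)
    (h : ∀ k, ∑ i ∈ Finset.range (m + 2), xDeriv φ i t k * a i +
      ∑ i ∈ Finset.range (m + 1), xDeriv ψ i t k * b i = 0) : tauF m φ ψ t = 0 := by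
  rw [tauF, doubleWronskian]
  refine Matrix.exists_mulVec_eq_zero_iff.mp
    ⟨fun j => if (j : ℕ) < m + 2 then a j else b (j - (m + 2)), ?_, ?_⟩
  · obtain ⟨i, hi, hai⟩ := hab
    intro h0
    have h1 := congrFun h0 ⟨i, by omega⟩
    rw [if_pos hi] at h1
    exact hai h1
  · ext k
    refine Eq.trans ?_ (h k)
    rw [← sum_columns (fun i => xDeriv φ i t k) (fun i => xDeriv ψ i t k)]
    simp only [Matrix.mulVec, dotProduct, Matrix.of_apply]

/-- Cramer's rule for the coefficient of `∂ₓᵐψ` in `∂ₓᵐ⁺²φ`. -/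
theorem tauG_eq {a b : ℕ → ℂ}
    (h : ∀ k, xDeriv φ (m + 2) t k = ∑ i ∈ Finset.range (m + 2), xDeriv φ i t k * a i +
      ∑ i ∈ Finset.range (m + 1), xDeriv ψ i t k * b i) :
    tauG m φ ψ t = (-1) ^ m * b m * tauF m φ ψ t := by
  rw [tauF, tauG, doubleWronskian, doubleWronskian]
  set F : Matrix (Fin (2 * m + 3)) (Fin (2 * m + 3)) ℂ := Matrix.of fun i j =>
    if (j : ℕ) < m + 2 then xDeriv φ (j : ℕ) t i else xDeriv ψ ((j : ℕ) - (m + 2)) t i with hF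
  set G : Matrix (Fin (2 * m + 3)) (Fin (2 * m + 3)) ℂ := Matrix.of fun i j =>
    if (j : ℕ) < m + 3 then xDeriv φ (j : ℕ) t i else xDeriv ψ ((j : ℕ) - (m + 3)) t i with hG
  set c : Fin (2 * m + 3) → ℂ := fun j => if (j : ℕ) < m + 2 then a j else b (j - (m + 2)) with hc
  set p : Fin (2 * m + 2 + 1) := ⟨m + 2, by omega⟩ with hp
  -- This cycle moves the column `∂ₓ^{m+2}φ` to the end and so turns `G` into `F` with its last
  -- column `∂ₓᵐψ` replaced. It has length `m+1`, hence the sign `(-1)^m`.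
  set σ : Equiv.Perm (Fin (2 * m + 2 + 1)) := Fin.cycleIcc p (Fin.last _) with hσ
  have hs : Equiv.Perm.sign σ = (-1) ^ m := by
    rw [hσ, Fin.sign_cycleIcc_of_le (Fin.le_last _)]
    congr 1
    simp only [hp, Fin.val_last]
    omega
  have h1 : G.submatrix id σ = F.updateCol (Fin.last (2 * m + 2)) fun k => ∑ j, c j • F k j := by
    ext k j
    rw [Matrix.submatrix_apply, id, Matrix.updateCol_apply]
    by_cases hj : j = Fin.last (2 * m + 2)
    · rw [if_pos hj, hj, hσ, Fin.cycleIcc_of_last (Fin.le_last _)]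
      have h2 := sum_columns (m := m) (fun i => xDeriv φ i t k) (fun i => xDeriv ψ i t k) a b
      rw [← h k] at h2
      simp only [hG, hF, hc, hp, Matrix.of_apply, smul_eq_mul]
      rw [if_pos (by omega), ← h2]
      exact Finset.sum_congr rfl fun j _ => mul_comm _ _
    · rw [if_neg hj]
      have hjl : (j : ℕ) < 2 * m + 2 := Fin.val_lt_last hj
      by_cases hjp : (j : ℕ) < m + 2
      · rw [hσ, Fin.cycleIcc_of_lt (Fin.lt_def.mpr hjp)]
        simp only [hG, hF, Matrix.of_apply]
        rw [if_pos hjp, if_pos (by omega)]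
      · have h3 : ((σ j : Fin (2 * m + 2 + 1)) : ℕ) = j + 1 := by
          rw [hσ, Fin.cycleIcc_of_ge_of_lt (Fin.le_def.mpr (by simp only [hp]; omega))
            (Fin.lt_def.mpr hjl), Fin.val_add_one_of_lt (Fin.lt_def.mpr hjl)]
        simp only [hG, hF, Matrix.of_apply]
        rw [h3, if_neg (by omega), if_neg hjp, show (j : ℕ) + 1 - (m + 3) = j - (m + 2) by omega]
  have h2 := congrArg Matrix.det h1
  rw [Matrix.det_permute', Matrix.det_updateCol_sum, hs, smul_eq_mul] at h2
  have h3 : c (Fin.last (2 * m + 2)) = b m := by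
    simp only [hc, Fin.val_last]
    rw [if_neg (by omega)]
    congr 1
    omega
  rw [h3] at h2
  have h4 : ((-1 : ℂ) ^ m) * (-1) ^ m = 1 := by rw [← mul_pow]; norm_num
  push_cast at h2
  linear_combination (-1) ^ m * h2 - G.det * h4

end DoubleWronskian

/-! ### The canonical matrices in block form -/

section Canonical

variable {m : ℕ}

/-- The column with blocks `u`, `s`, `v`. -/
def joinVec (u : Fin (m + 1) → ℂ) (s : Fin 1 → ℂ) (v : Fin (m + 1) → ℂ) : Fin (2 * m + 3) → ℂ :=
  fun i => Sum.elim u (Sum.elim s v) ((blockEquiv m).symm i)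

/-- The first block of a column. -/
def fstBlock (w : Fin (2 * m + 3) → ℂ) : Fin (m + 1) → ℂ := fun i => w (blockEquiv m (Sum.inl i))

/-- The middle block of a column. -/
def midBlock (w : Fin (2 * m + 3) → ℂ) : Fin 1 → ℂ :=
  fun i => w (blockEquiv m (Sum.inr (Sum.inl i)))

/-- The last block of a column. -/
def lastBlock (w : Fin (2 * m + 3) → ℂ) : Fin (m + 1) → ℂ :=
  fun i => w (blockEquiv m (Sum.inr (Sum.inr i)))

@[simp]
theorem fstBlock_joinVec (u : Fin (m + 1) → ℂ) (s : Fin 1 → ℂ) (v : Fin (m + 1) → ℂ) :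
    fstBlock (joinVec u s v) = u := by
  ext i; simp [fstBlock, joinVec]

@[simp]
theorem midBlock_joinVec (u : Fin (m + 1) → ℂ) (s : Fin 1 → ℂ) (v : Fin (m + 1) → ℂ) :
    midBlock (joinVec u s v) = s := by
  ext i; simp [midBlock, joinVec]

@[simp]
theorem lastBlock_joinVec (u : Fin (m + 1) → ℂ) (s : Fin 1 → ℂ) (v : Fin (m + 1) → ℂ) :
    lastBlock (joinVec u s v) = v := by
  ext i; simp [lastBlock, joinVec]

theorem joinVec_blocks (w : Fin (2 * m + 3) → ℂ) :
    joinVec (fstBlock w) (midBlock w) (lastBlock w) = w := by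
  ext i
  obtain ⟨x, rfl⟩ := (blockEquiv m).surjective i
  rcases x with i | i | i <;> simp [joinVec, fstBlock, midBlock, lastBlock]

theorem blockVec_eq (u v : Fin (m + 1) → ℂ) : blockVec u v = joinVec u (fun _ => 1) v := rfl

theorem reindex_mulVec_joinVec
    (M : Matrix (Fin (m + 1) ⊕ (Fin 1 ⊕ Fin (m + 1))) (Fin (m + 1) ⊕ (Fin 1 ⊕ Fin (m + 1))) ℂ)
    (u : Fin (m + 1) → ℂ) (s : Fin 1 → ℂ) (v : Fin (m + 1) → ℂ) :
    Matrix.reindex (blockEquiv m) (blockEquiv m) M *ᵥ joinVec u s v =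
      fun i => (M *ᵥ Sum.elim u (Sum.elim s v)) ((blockEquiv m).symm i) := by
  rw [Matrix.reindex_apply, Matrix.submatrix_mulVec_equiv]
  have h : joinVec u s v ∘ (blockEquiv m).symm.symm = Sum.elim u (Sum.elim s v) := by
    ext x; simp [joinVec]
  rw [h]
  rfl

theorem canonicalA_mulVec (K : Matrix (Fin (m + 1)) (Fin (m + 1)) ℂ) (u : Fin (m + 1) → ℂ)
    (s : Fin 1 → ℂ) (v : Fin (m + 1) → ℂ) :
    canonicalA K *ᵥ joinVec u s v = joinVec (K *ᵥ u) 0 (-K *ᵥ v) := by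
  rw [canonicalA, reindex_mulVec_joinVec]
  ext i
  rw [joinVec, Matrix.fromBlocks_mulVec, Sum.elim_comp_inl, Sum.elim_comp_inr,
    Matrix.fromBlocks_mulVec, Sum.elim_comp_inl, Sum.elim_comp_inr]
  simp

theorem canonicalT_mulVec (u : Fin (m + 1) → ℂ) (s : Fin 1 → ℂ) (v : Fin (m + 1) → ℂ) :
    canonicalT m *ᵥ joinVec u s v = joinVec v s u := by
  rw [canonicalT, reindex_mulVec_joinVec]
  ext i
  rw [joinVec, Matrix.fromBlocks_mulVec, Sum.elim_comp_inl, Sum.elim_comp_inr,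
    Matrix.fromBlocks_mulVec, Sum.elim_comp_inl, Sum.elim_comp_inr, Matrix.fromRows_mulVec,
    Matrix.fromCols_mulVec, Sum.elim_comp_inl, Sum.elim_comp_inr]
  simp only [Matrix.zero_mulVec, Matrix.one_mulVec, zero_add, add_zero]
  congr 1
  ext x
  rcases x with x | x | x <;> simp

theorem matrix_ext_joinVec {n : Type*} {M M' : Matrix n (Fin (2 * m + 3)) ℂ}
    (h : ∀ u s v, M *ᵥ joinVec u s v = M' *ᵥ joinVec u s v) : M = M' := by
  refine Matrix.mulVec_injective (funext fun w => ?_)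
  rw [← joinVec_blocks w]
  exact h _ _ _

theorem canonicalT_mul_canonicalA (K : Matrix (Fin (m + 1)) (Fin (m + 1)) ℂ) :
    canonicalT m * canonicalA K = -canonicalA K * canonicalT m := by
  refine matrix_ext_joinVec fun u s v => ?_
  rw [neg_mul, Matrix.neg_mulVec, ← Matrix.mulVec_mulVec, ← Matrix.mulVec_mulVec,
    canonicalA_mulVec, canonicalT_mulVec, canonicalT_mulVec, canonicalA_mulVec]
  ext i
  simp only [joinVec, Pi.neg_apply]
  rcases (blockEquiv m).symm i with x | x | x <;> simp [Matrix.neg_mulVec]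

theorem canonicalT_sq : canonicalT m ^ 2 = 1 := by
  refine matrix_ext_joinVec fun u s v => ?_
  rw [pow_two, ← Matrix.mulVec_mulVec, canonicalT_mulVec, canonicalT_mulVec, Matrix.one_mulVec]

theorem canonicalT_det : (canonicalT m).det = (-1) ^ (m + 1) := by
  rw [canonicalT, Matrix.det_reindex_self]
  set C : Matrix (Fin 1 ⊕ Fin (m + 1)) (Fin (m + 1)) ℂ := Matrix.fromRows 0 1 with hC
  set B : Matrix (Fin (m + 1)) (Fin 1 ⊕ Fin (m + 1)) ℂ := Matrix.fromCols 0 1 with hB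
  have hBC : B * C = 1 := by
    rw [hB, hC, Matrix.fromCols_mul_fromRows]; simp
  have hCB : C * B = Matrix.fromBlocks 0 0 0 1 := by
    rw [hB, hC, Matrix.fromRows_mul_fromCols]; simp
  have hDC : (Matrix.fromBlocks 1 0 0 0 : Matrix (Fin 1 ⊕ Fin (m + 1)) (Fin 1 ⊕ Fin (m + 1)) ℂ) * C
      = 0 := by
    rw [hC, Matrix.fromBlocks_mul_fromRows]; simp
  -- The unipotent second factor makes the upper left block the identity. The Schur complement is
  -- then `diag(1, 0) - CB = diag(1, -I)`.
  have h1 := Matrix.det_mul (Matrix.fromBlocks 0 B C (Matrix.fromBlocks 1 0 0 0))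
    (Matrix.fromBlocks 1 0 C 1)
  rw [Matrix.det_fromBlocks_zero₁₂, Matrix.fromBlocks_multiply, Matrix.zero_mul, hBC, hDC] at h1
  simp only [Matrix.mul_one, Matrix.mul_zero, zero_add, add_zero, Matrix.det_one, mul_one] at h1
  rw [← h1, Matrix.det_fromBlocks_one₁₁, hCB, sub_eq_add_neg, Matrix.fromBlocks_neg,
    Matrix.fromBlocks_add]
  simp [Matrix.det_neg]

theorem canonicalA_pow_mulVec (K : Matrix (Fin (m + 1)) (Fin (m + 1)) ℂ) (j : ℕ)
    (u : Fin (m + 1) → ℂ) (s : Fin 1 → ℂ) (v : Fin (m + 1) → ℂ) :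
    canonicalA K ^ j *ᵥ joinVec u s v =
      joinVec (K ^ j *ᵥ u) (if j = 0 then s else 0) ((-K) ^ j *ᵥ v) := by
  induction j with
  | zero => simp
  | succ j ih =>
    rw [pow_succ', ← Matrix.mulVec_mulVec, ih, canonicalA_mulVec, Matrix.mulVec_mulVec,
      Matrix.mulVec_mulVec, ← pow_succ', ← pow_succ', if_neg j.succ_ne_zero]

theorem smul_canonicalA (c : ℂ) (K : Matrix (Fin (m + 1)) (Fin (m + 1)) ℂ) :
    c • canonicalA K = canonicalA (c • K) := by
  refine matrix_ext_joinVec fun u s v => ?_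
  rw [Matrix.smul_mulVec, canonicalA_mulVec, canonicalA_mulVec]
  ext i
  simp only [joinVec, Pi.smul_apply]
  rcases (blockEquiv m).symm i with x | x | x <;> simp [Matrix.neg_mulVec, Matrix.smul_mulVec]

end Canonical

/-! ### Reduction of the double Wronskian solution to a Wronskian -/

/-- Needed because `kdvR` agrees with the Wronskian potential only where `f ≠ 0`; agreement near the
point along each time suffices. -/
theorem SolvesKdVHierarchy.congr {Ω Ω' : Set Times} {r r' : Times → ℂ}
    (h : SolvesKdVHierarchy Ω' r') (hΩ : Ω ⊆ Ω')
    (hr : ∀ t ∈ Ω, ∀ l, ∀ᶠ s in 𝓝 (t l), r (Function.update t l s) = r' (Function.update t l s)) :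
    SolvesKdVHierarchy Ω r := by
  intro t ht
  obtain ⟨h1, h2⟩ := h t (hΩ ht)
  have h3 : ∀ j, xDeriv r j t = xDeriv r' j t := fun j =>
    Filter.EventuallyEq.iteratedDeriv_eq j (hr t ht 0)
  refine ⟨h1.congr (Filter.EventuallyEq.symm (hr t ht 0)), fun l => ?_⟩
  have h4 := (h2 l).congr_of_eventuallyEq (hr t ht l)
  have h5 : ∀ P, evalDiffPoly P (fun _ => 1) r t = evalDiffPoly P (fun _ => 1) r' t := fun P => by
    simp only [evalDiffPoly, h3]
  rwa [h5]

section Reduction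

variable {m : ℕ}

/-- The vectors `∂ₓʲ (u - v)`, where `u` and `v` are the outer blocks of `φ`. -/
def outerWave (κ : Matrix (Fin (m + 1)) (Fin (m + 1)) ℂ) (φ : Times → Fin (2 * m + 3) → ℂ) (j : ℕ)
    (t : Times) : Fin (m + 1) → ℂ :=
  κ ^ j *ᵥ fstBlock (φ t) - (-κ) ^ j *ᵥ lastBlock (φ t)

variable {κ : Matrix (Fin (m + 1)) (Fin (m + 1)) ℂ} {dom : Set Times}
  {φ ψ : Times → Fin (2 * m + 3) → ℂ}

/-- The blocks `u` and `v` flow under `κ` and `-κ`. These have the same even powers, so `u - v`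
satisfies a closed second-order equation. -/
theorem isKdVWave_outerWave (hφ : IsLinearFlow (canonicalA κ) dom φ) :
    IsKdVWave (κ ^ 2) (outerWave κ φ) dom where
  update_mem := hφ.update_mem
  second t _ j := by
    rw [outerWave, outerWave, Matrix.mulVec_sub, Matrix.mulVec_mulVec, Matrix.mulVec_mulVec,
      ← neg_sq κ, ← pow_add, neg_sq κ, ← pow_add, add_comm 2 j]
  hasDerivAt t ht l j i := by
    have h1 := hφ.hasDerivAt t ht l
    have h2 : canonicalA κ ^ (2 * l + 1) *ᵥ φ t =
        joinVec (κ ^ (2 * l + 1) *ᵥ fstBlock (φ t)) 0 ((-κ) ^ (2 * l + 1) *ᵥ lastBlock (φ t)) := by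
      conv_lhs => rw [← joinVec_blocks (φ t)]
      rw [canonicalA_pow_mulVec, if_neg (by omega)]
    rw [h2] at h1
    have hu : ∀ i, HasDerivAt (fun s => fstBlock (φ (Function.update t l s)) i)
        (((4 : ℂ) ^ l • (κ ^ (2 * l + 1) *ᵥ fstBlock (φ t))) i) (t l) := fun i => by
      refine (h1 (blockEquiv m (Sum.inl i))).congr_deriv ?_
      simp [joinVec]
    have hv : ∀ i, HasDerivAt (fun s => lastBlock (φ (Function.update t l s)) i)
        (((4 : ℂ) ^ l • ((-κ) ^ (2 * l + 1) *ᵥ lastBlock (φ t))) i) (t l) := fun i => by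
      refine (h1 (blockEquiv m (Sum.inr (Sum.inr i)))).congr_deriv ?_
      simp [joinVec]
    have h3 := hasDerivAt_mulVec (E := fun _ => κ ^ j) (E' := 0)
      (fun i j => hasDerivAt_const _ _) hu i
    have h4 := hasDerivAt_mulVec (E := fun _ => (-κ) ^ j) (E' := 0)
      (fun i j => hasDerivAt_const _ _) hv i
    refine (h3.sub h4).congr_deriv ?_
    rw [Matrix.zero_mulVec, Matrix.zero_mulVec, zero_add, zero_add, ← Pi.sub_apply]
    refine congrFun ?_ i
    have hA : (κ ^ 2) ^ l * κ ^ (j + 1) = κ ^ j * κ ^ (2 * l + 1) := by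
      rw [← pow_mul, ← pow_add, ← pow_add]; congr 1; ring
    have hB : (κ ^ 2) ^ l * (-κ) ^ (j + 1) = (-κ) ^ j * (-κ) ^ (2 * l + 1) := by
      rw [← neg_sq κ, ← pow_mul, ← pow_add, ← pow_add]; congr 1; ring
    rw [Matrix.mulVec_smul, Matrix.mulVec_smul, ← smul_sub, outerWave, Matrix.mulVec_sub,
      Matrix.mulVec_mulVec, Matrix.mulVec_mulVec, Matrix.mulVec_mulVec, Matrix.mulVec_mulVec, hA, hB]

theorem xDeriv_canonical (hφ : IsLinearFlow (canonicalA κ) dom φ) {t : Times} (ht : t ∈ dom)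
    (j : ℕ) : xDeriv φ j t = joinVec (κ ^ j *ᵥ fstBlock (φ t)) (if j = 0 then midBlock (φ t) else 0)
      ((-κ) ^ j *ᵥ lastBlock (φ t)) := by
  rw [hφ.xDeriv_eq ht, ← canonicalA_pow_mulVec, joinVec_blocks]

theorem xDeriv_canonicalT (hφ : IsLinearFlow (canonicalA κ) dom φ)
    (hψ : ∀ t ∈ dom, ψ t = canonicalT m *ᵥ φ t) {t : Times} (ht : t ∈ dom) (j : ℕ) :
    xDeriv ψ j t = canonicalT m *ᵥ xDeriv φ j t := by
  have h1 := (hφ.intertwine (canonicalT_mul_canonicalA κ)).congr subset_rfl hφ.update_mem hψ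
  rw [h1.xDeriv_eq ht, hφ.xDeriv_eq ht, hψ t ht, Matrix.mulVec_mulVec, Matrix.mulVec_mulVec,
    pow_intertwine (canonicalT_mul_canonicalA κ)]

theorem kdvQ_canonical (hφ : IsLinearFlow (canonicalA κ) dom φ)
    (hψ : ∀ t ∈ dom, ψ t = canonicalT m *ᵥ φ t) {t : Times} (ht : t ∈ dom)
    (hf : tauF m φ ψ t ≠ 0) : kdvQ m φ ψ t = (canonicalT m).det := by
  have h1 := xDeriv_canonicalT hφ hψ ht
  rw [kdvQ, tauH_eq h1 fun i => ?_, mul_div_cancel_right₀ _ hf]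
  rw [h1, Matrix.mulVec_mulVec, ← pow_two, canonicalT_sq, Matrix.one_mulVec]

/-- A relation `∑ c_j e^{(j)} = 0` gives `∑ c_j (φ^{(j)} - ψ^{(j)}) = 0`: the blocks of `φ^{(j)} -
ψ^{(j)}` are `e^{(j)}`, `0` and `-e^{(j)}`. This is a relation between the columns of `f`. -/
theorem waveMatrix_det_ne_zero (hφ : IsLinearFlow (canonicalA κ) dom φ)
    (hψ : ∀ t ∈ dom, ψ t = canonicalT m *ᵥ φ t) {t : Times} (ht : t ∈ dom)
    (hf : tauF m φ ψ t ≠ 0) : (IsKdVWave.waveMatrix (outerWave κ φ) 0 t).det ≠ 0 := by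
  intro h0
  obtain ⟨c, hc, hc0⟩ := Matrix.exists_mulVec_eq_zero_iff.mpr h0
  refine hf (tauF_eq_zero (a := fun i => if h : i < m + 1 then c ⟨i, h⟩ else 0)
    (b := fun i => -if h : i < m + 1 then c ⟨i, h⟩ else 0) ?_ fun k => ?_)
  · obtain ⟨i, hi⟩ := Function.ne_iff.mp hc
    exact ⟨i, by omega, by rw [dif_pos i.isLt]; exact hi⟩
  · have h1 : ∀ i, ∑ j : Fin (m + 1), outerWave κ φ j t i * c j = 0 := fun i => congrFun hc0 i
    rw [Finset.sum_range_succ, dif_neg (lt_irrefl _), mul_zero, add_zero,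
      ← Finset.sum_add_distrib, Finset.sum_range]
    simp only [Fin.is_lt, dite_true, mul_neg, ← sub_eq_add_neg, ← sub_mul, Fin.eta]
    simp only [xDeriv_canonicalT hφ hψ ht, xDeriv_canonical hφ ht, canonicalT_mulVec]
    obtain ⟨x, rfl⟩ := (blockEquiv m).surjective k
    rcases x with i | i | i
    · simpa [joinVec, outerWave] using h1 i
    · simp [joinVec]
    · have h2 := congrArg Neg.neg (h1 i)
      rw [← Finset.sum_neg_distrib, neg_zero] at h2
      simpa [joinVec, outerWave, ← neg_mul] using h2

/-- The point is the expansion `φ^{(m+2)} = ∑ γ_i φ^{(i+1)} + ½ ∑ δ_i (φ^{(i)} - ψ^{(i)})` with `δ =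
γ'`. By Cramer's rule its coefficient `-½ δ_m` at `ψ^{(m)}` determines the numerator of `r`. -/
theorem kdvR_canonical (hφ : IsLinearFlow (canonicalA κ) dom φ)
    (hψ : ∀ t ∈ dom, ψ t = canonicalT m *ᵥ φ t) {t : Times} (ht : t ∈ dom)
    (hf : tauF m φ ψ t ≠ 0) :
    kdvR m φ ψ t = IsKdVWave.wavePotential (κ ^ 2) (outerWave κ φ) t := by
  have hdet := waveMatrix_det_ne_zero hφ hψ ht hf
  set e := outerWave κ φ with he
  set γ := IsKdVWave.waveCoeff e t with hγ
  set δ := IsKdVWave.waveFlow (κ ^ 2) e 0 t with hδ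
  set u := fstBlock (φ t) with hu
  set v := lastBlock (φ t) with hv
  have hsolve : ∀ w : Fin (m + 1) → ℂ, IsKdVWave.waveMatrix e 0 t *ᵥ
      ((IsKdVWave.waveMatrix e 0 t)⁻¹ *ᵥ w) = w := fun w => by
    rw [Matrix.mulVec_mulVec, Matrix.mul_nonsing_inv _ (isUnit_iff_ne_zero.mpr hdet),
      Matrix.one_mulVec]
  have hcomb : ∀ k w, IsKdVWave.waveMatrix e k t *ᵥ w = ∑ j : Fin (m + 1), w j • e (j + k) t := by
    intro k w
    ext i
    simp [Matrix.mulVec, dotProduct, IsKdVWave.waveMatrix, mul_comm]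
  have h1 : ∑ j : Fin (m + 1), γ j • e j t = e (m + 1) t := by
    have h := hcomb 0 γ
    rw [hγ, IsKdVWave.waveCoeff, hsolve] at h
    exact h.symm
  have h2 : ∑ j : Fin (m + 1), δ j • e j t = e (m + 2) t - ∑ j : Fin (m + 1), γ j • e (j + 1) t := by
    have h := hcomb 0 δ
    have h' : IsKdVWave.waveMatrix e 0 t *ᵥ δ =
        e (m + 2) t - ∑ j : Fin (m + 1), γ j • e (j + 1) t := by
      rw [hδ, IsKdVWave.waveFlow, hsolve, pow_zero, Matrix.one_mulVec, hcomb 1]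
    rw [h'] at h
    exact h.symm
  -- Applying `κ` to the relation for `e^{(m+1)}` turns the minus sign between `u` and `v` into a
  -- plus, while `h4` is the differentiated relation. Their half sum and half difference give the
  -- outer blocks of the expansion.
  have h3 : ∀ i, ∑ j : Fin (m + 1), γ j * ((κ ^ ((j : ℕ) + 1) *ᵥ u) i +
      ((-κ) ^ ((j : ℕ) + 1) *ᵥ v) i) = (κ ^ (m + 2) *ᵥ u) i + ((-κ) ^ (m + 2) *ᵥ v) i := by
    have hκ : ∀ j, κ *ᵥ e j t = κ ^ (j + 1) *ᵥ u + (-κ) ^ (j + 1) *ᵥ v := fun j => by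
      rw [he, outerWave, Matrix.mulVec_sub, Matrix.mulVec_mulVec, Matrix.mulVec_mulVec, ← pow_succ',
        pow_succ' (-κ), neg_mul, Matrix.neg_mulVec, sub_eq_add_neg]
    have h := congrArg (fun w => κ *ᵥ w) h1
    simp only [Matrix.mulVec_sum, Matrix.mulVec_smul, hκ] at h
    intro i
    simpa [mul_add] using congrFun h i
  have h4 : ∀ i, ∑ j : Fin (m + 1), δ j * ((κ ^ (j : ℕ) *ᵥ u) i - ((-κ) ^ (j : ℕ) *ᵥ v) i) =
      (κ ^ (m + 2) *ᵥ u) i - ((-κ) ^ (m + 2) *ᵥ v) i - ∑ j : Fin (m + 1), γ j *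
        ((κ ^ ((j : ℕ) + 1) *ᵥ u) i - ((-κ) ^ ((j : ℕ) + 1) *ᵥ v) i) := by
    intro i
    simpa [he, outerWave] using congrFun h2 i
  set γ' : ℕ → ℂ := fun i => if h : i < m + 1 then γ ⟨i, h⟩ else 0 with hγ'
  set δ' : ℕ → ℂ := fun i => if h : i < m + 1 then δ ⟨i, h⟩ else 0 with hδ'
  have hG : tauG m φ ψ t = (-1) ^ m * (-(1 / 2) * δ' m) * tauF m φ ψ t := by
    refine tauG_eq (a := fun i => (if i = 0 then 0 else γ' (i - 1)) + 1 / 2 * δ' i)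
      (b := fun i => -(1 / 2) * δ' i) fun k => ?_
    have hδm : δ' (m + 1) = 0 := dif_neg (lt_irrefl _)
    simp only [mul_add, Finset.sum_add_distrib]
    rw [Finset.sum_range_succ' (fun i => xDeriv φ i t k * if i = 0 then 0 else γ' (i - 1)),
      Finset.sum_range_succ (fun i => xDeriv φ i t k * (1 / 2 * δ' i)), hδm]
    simp only [if_true, mul_zero, add_zero, Nat.succ_ne_zero, if_false, Nat.add_sub_cancel,
      Finset.sum_range, hγ', hδ', Fin.is_lt, dite_true, Fin.eta]
    simp only [xDeriv_canonicalT hφ hψ ht, xDeriv_canonical hφ ht, canonicalT_mulVec]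
    obtain ⟨x, rfl⟩ := (blockEquiv m).surjective k
    rcases x with i | i | i
    · have h5 := h3 i
      have h6 := h4 i
      simp only [mul_add, mul_sub, Finset.sum_add_distrib, Finset.sum_sub_distrib] at h5 h6
      simp only [joinVec, Equiv.symm_apply_apply, Sum.elim_inl, ← hu, ← hv]
      have h7 : ∀ w : Fin (m + 1) → ℂ, ∀ c : ℂ, ∑ j, w j * (c * δ j) = c * ∑ j, δ j * w j :=
        fun w c => by rw [Finset.mul_sum]; exact Finset.sum_congr rfl fun j _ => by ring
      have h8 : ∀ w : Fin (m + 1) → ℂ, ∑ j, w j * γ j = ∑ j, γ j * w j :=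
        fun w => Finset.sum_congr rfl fun j _ => mul_comm _ _
      rw [h7 fun j => (κ ^ (j : ℕ) *ᵥ u) i, h7 fun j => ((-κ) ^ (j : ℕ) *ᵥ v) i,
        h8 fun j => (κ ^ ((j : ℕ) + 1) *ᵥ u) i]
      linear_combination (-1 / 2) * h5 - (1 / 2) * h6
    · simp [joinVec, neg_mul]
    · have h5 := h3 i
      have h6 := h4 i
      simp only [mul_add, mul_sub, Finset.sum_add_distrib, Finset.sum_sub_distrib] at h5 h6
      simp only [joinVec, Equiv.symm_apply_apply, Sum.elim_inr, ← hu, ← hv]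
      have h7 : ∀ w : Fin (m + 1) → ℂ, ∀ c : ℂ, ∑ j, w j * (c * δ j) = c * ∑ j, δ j * w j :=
        fun w c => by rw [Finset.mul_sum]; exact Finset.sum_congr rfl fun j _ => by ring
      have h8 : ∀ w : Fin (m + 1) → ℂ, ∑ j, w j * γ j = ∑ j, γ j * w j :=
        fun w => Finset.sum_congr rfl fun j _ => mul_comm _ _
      rw [h7 fun j => (κ ^ (j : ℕ) *ᵥ u) i, h7 fun j => ((-κ) ^ (j : ℕ) *ᵥ v) i,
        h8 fun j => ((-κ) ^ ((j : ℕ) + 1) *ᵥ v) i]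
      linear_combination (-1 / 2) * h5 + (1 / 2) * h6
  have hδm : δ' m = δ (Fin.last m) := dif_pos m.lt_succ_self
  have hs : ((-1 : ℂ) ^ m) * (-1) ^ m = 1 := by rw [← mul_pow]; norm_num
  rw [kdvR, hG, IsKdVWave.wavePotential, ← hδ, hδm]
  field_simp
  linear_combination (-4 * δ (Fin.last m)) * hs

theorem continuousAt_tauF (hφ : IsLinearFlow (canonicalA κ) dom φ)
    (hψ : ∀ t ∈ dom, ψ t = canonicalT m *ᵥ φ t) {t : Times} (ht : t ∈ dom) (l : ℕ) :
    ContinuousAt (fun s => tauF m φ ψ (Function.update t l s)) (t l) := by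
  have h0 : ContinuousAt (fun s => φ (Function.update t l s)) (t l) :=
    continuousAt_pi.mpr fun i => (hφ.hasDerivAt t ht l i).continuousAt
  have h1 : (fun s => tauF m φ ψ (Function.update t l s)) = fun s => (Matrix.of fun i j =>
      if ((j : Fin (2 * m + 3)) : ℕ) < m + 2
      then (canonicalA κ ^ (j : ℕ) *ᵥ φ (Function.update t l s)) i
      else (canonicalT m *ᵥ (canonicalA κ ^ ((j : ℕ) - (m + 2)) *ᵥ φ (Function.update t l s))) i).det
      := by
    ext s
    have hs := hφ.update_mem t ht l s
    rw [tauF, doubleWronskian]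
    simp only [xDeriv_canonicalT hφ hψ hs, hφ.xDeriv_eq hs]
  have hmv : ∀ M : Matrix (Fin (2 * m + 3)) (Fin (2 * m + 3)) ℂ, Continuous fun w => M *ᵥ w :=
    fun M => continuous_const.matrix_mulVec continuous_id
  rw [h1]
  refine ContinuousAt.comp (g := fun M : Matrix (Fin (2 * m + 3)) (Fin (2 * m + 3)) ℂ => M.det)
    (Continuous.matrix_det continuous_id).continuousAt ?_
  refine continuousAt_pi.mpr fun i => continuousAt_pi.mpr fun j => ?_
  simp only [Matrix.of_apply]
  split_ifs
  · exact (continuous_apply i).continuousAt.comp ((hmv _).continuousAt.comp h0)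
  · exact (continuous_apply i).continuousAt.comp
      ((hmv _).continuousAt.comp ((hmv _).continuousAt.comp h0))

theorem solvesKdVHierarchy_canonical (hφ : IsLinearFlow (canonicalA κ) dom φ)
    (hψ : ∀ t ∈ dom, ψ t = canonicalT m *ᵥ φ t) :
    SolvesKdVHierarchy {t | t ∈ dom ∧ tauF m φ ψ t ≠ 0} (kdvR m φ ψ) := by
  refine (isKdVWave_outerWave hφ).solvesKdVHierarchy.congr ?_ ?_
  · rintro t ⟨ht, hf⟩
    exact ⟨ht, waveMatrix_det_ne_zero hφ hψ ht hf⟩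
  · rintro t ⟨ht, hf⟩ l
    have hev := (continuousAt_tauF hφ hψ ht l).eventually_ne
      (by simpa only [Function.update_eq_self] using hf)
    filter_upwards [hev] with s hs
    exact kdvR_canonical hφ hψ (hφ.update_mem t ht l s) hs

end Reduction

/-! ### Similar pairs of matrices -/

section Similar

variable {N : ℕ} {A P : Matrix (Fin N) (Fin N) ℂ}

theorem mul_mul_inv_intertwine (hP : IsUnit P.det) (A : Matrix (Fin N) (Fin N) ℂ) :
    P * A = P * A * P⁻¹ * P := by
  rw [Matrix.mul_assoc (P * A), Matrix.nonsing_inv_mul _ hP, Matrix.mul_one]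

theorem mem_seriesDomain_similar (hP : IsUnit P.det) {t : Times} (ht : t ∈ seriesDomain A) :
    t ∈ seriesDomain (P * A * P⁻¹) := by
  have h1 := Summable.map ht ((Matrix.addMonoidHomMulRight P⁻¹).comp (Matrix.addMonoidHomMulLeft P))
    ((continuous_const.matrix_mul continuous_id).matrix_mul continuous_const)
  refine h1.congr fun j => ?_
  simp only [Function.comp_apply, AddMonoidHom.comp_apply, Matrix.addMonoidHomMulLeft_apply,
    Matrix.addMonoidHomMulRight_apply]
  rw [Matrix.mul_smul, Matrix.smul_mul, pow_intertwine (mul_mul_inv_intertwine hP A),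
    Matrix.mul_assoc, Matrix.mul_nonsing_inv _ hP, Matrix.mul_one]

theorem xDeriv_phiVec_similar (hP : IsUnit P.det) (C : Fin N → ℂ) {t : Times}
    (ht : t ∈ seriesDomain A) (i : ℕ) :
    xDeriv (phiVec (P * A * P⁻¹) (P *ᵥ C)) i t = P *ᵥ xDeriv (phiVec A C) i t := by
  have ht' := mem_seriesDomain_similar hP ht
  have h1 : P * ((1 / 2 : ℂ) • A) = (1 / 2 : ℂ) • (P * A * P⁻¹) * P := by
    rw [Matrix.mul_smul, Matrix.smul_mul, ← mul_mul_inv_intertwine hP]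
  rw [(isLinearFlow_phiVec A C).xDeriv_eq ht, (isLinearFlow_phiVec _ _).xDeriv_eq ht',
    ← phiVec_intertwine (mul_mul_inv_intertwine hP A) ht ht', Matrix.mulVec_mulVec,
    Matrix.mulVec_mulVec, pow_intertwine h1]

theorem doubleWronskian_similar (hP : IsUnit P.det) (T : Matrix (Fin N) (Fin N) ℂ) (C : Fin N → ℂ)
    {t : Times} (ht : t ∈ seriesDomain A) (p : ℕ) :
    doubleWronskian p (phiVec (P * A * P⁻¹) (P *ᵥ C))
      (psiVec (P * A * P⁻¹) ((P * T * P⁻¹) *ᵥ (P *ᵥ C))) t =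
      P.det * doubleWronskian p (phiVec A C) (psiVec A (T *ᵥ C)) t := by
  refine doubleWronskian_mulVec (xDeriv_phiVec_similar hP C ht) (fun i => ?_) p
  rw [psiVec_eq, psiVec_eq, Matrix.mulVec_mulVec, ← mul_mul_inv_intertwine hP,
    ← Matrix.mulVec_mulVec, ← xDeriv_phiVec_similar hP _ (by rwa [seriesDomain_neg]),
    Matrix.mul_neg, Matrix.neg_mul]

theorem similar_anticommute (hP : IsUnit P.det) {T : Matrix (Fin N) (Fin N) ℂ}
    (h : A * T + T * A = 0) :
    (P * A * P⁻¹) * (P * T * P⁻¹) + (P * T * P⁻¹) * (P * A * P⁻¹) = 0 := by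
  have h1 : ∀ X Y : Matrix (Fin N) (Fin N) ℂ,
      (P * X * P⁻¹) * (P * Y * P⁻¹) = P * (X * Y) * P⁻¹ := fun X Y => by
    rw [← Matrix.mul_assoc, ← Matrix.mul_assoc, ← mul_mul_inv_intertwine hP, Matrix.mul_assoc P]
  rw [h1, h1, ← Matrix.add_mul, ← Matrix.mul_add, h, Matrix.mul_zero, Matrix.zero_mul]

theorem similar_sq (hP : IsUnit P.det) {T : Matrix (Fin N) (Fin N) ℂ} (h : T ^ 2 = 1) :
    (P * T * P⁻¹) ^ 2 = 1 := by
  rw [pow_two, ← Matrix.mul_assoc, ← Matrix.mul_assoc, ← mul_mul_inv_intertwine hP,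
    Matrix.mul_assoc P, ← pow_two, h, Matrix.mul_one, Matrix.mul_nonsing_inv _ hP]

end Similar

/-! ### The exponential vectors in block form -/

section Blocks

variable {m : ℕ} {K : Matrix (Fin (m + 1)) (Fin (m + 1)) ℂ}

/-- Only odd powers keep the form `diag(·, 0, -·)`; the series of the odd times involves no others.
-/
theorem canonicalA_pow_odd (K : Matrix (Fin (m + 1)) (Fin (m + 1)) ℂ) (j : ℕ) :
    canonicalA K ^ (2 * j + 1) = canonicalA (K ^ (2 * j + 1)) := by
  refine matrix_ext_joinVec fun u s v => ?_
  rw [canonicalA_pow_mulVec, canonicalA_mulVec, if_neg (by omega), (odd_two_mul_add_one j).neg_pow]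

/-- `canonicalA` as an additive homomorphism. -/
def canonicalAHom (m : ℕ) : Matrix (Fin (m + 1)) (Fin (m + 1)) ℂ →+
    Matrix (Fin (2 * m + 3)) (Fin (2 * m + 3)) ℂ where
  toFun := canonicalA
  map_zero' := by
    refine matrix_ext_joinVec fun u s v => ?_
    rw [canonicalA_mulVec]
    ext i
    simp only [joinVec]
    rcases (blockEquiv m).symm i with x | x | x <;> simp
  map_add' K K' := by
    refine matrix_ext_joinVec fun u s v => ?_
    rw [Matrix.add_mulVec, canonicalA_mulVec, canonicalA_mulVec, canonicalA_mulVec]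
    ext i
    simp only [joinVec, Pi.add_apply]
    rcases (blockEquiv m).symm i with x | x | x <;>
      simp [Matrix.neg_mulVec, Matrix.add_mulVec, add_comm]

theorem continuous_canonicalA : Continuous (canonicalA (m := m)) := by
  refine Continuous.matrix_reindex ?_ _ _
  exact Continuous.matrix_fromBlocks continuous_id continuous_const continuous_const
    (Continuous.matrix_fromBlocks continuous_const continuous_const continuous_const continuous_neg)

theorem mem_seriesDomain_canonicalA {t : Times} (ht : t ∈ seriesDomain K) :
    t ∈ seriesDomain (canonicalA K) := by
  refine (Summable.map ht (canonicalAHom m) continuous_canonicalA).congr fun j => ?_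
  rw [canonicalA_pow_odd, smul_canonicalA]
  rfl

/-- The matrix selecting the entries with indices `f i`. -/
def selectRows {ι κ : Type*} [DecidableEq ι] (f : κ → ι) : Matrix κ ι ℂ :=
  (1 : Matrix ι ι ℂ).submatrix f id

theorem selectRows_mulVec {ι κ : Type*} [Fintype ι] [DecidableEq ι] (f : κ → ι) (v : ι → ℂ) :
    selectRows f *ᵥ v = fun i => v (f i) := by
  ext i
  simp [selectRows, Matrix.mulVec, dotProduct, Matrix.one_apply]

theorem phiVec_zero {N : ℕ} (C : Fin N → ℂ) (t : Times) : phiVec 0 C t = C := by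
  simp [phiVec]

theorem mem_seriesDomain_zero {N : ℕ} (t : Times) :
    t ∈ seriesDomain (0 : Matrix (Fin N) (Fin N) ℂ) := by
  simp only [seriesDomain, Set.mem_ofPred_eq, ne_eq, Nat.succ_ne_zero, not_false_eq_true,
    zero_pow, smul_zero]
  exact summable_zero

/-- Selecting the rows of a block intertwines `canonicalA K` with the matrix `K`, `0` or `-K` of
that block. -/
theorem phiVec_canonicalA {t : Times} (ht : t ∈ seriesDomain K) (u : Fin (m + 1) → ℂ)
    (s : Fin 1 → ℂ) (v : Fin (m + 1) → ℂ) :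
    phiVec (canonicalA K) (joinVec u s v) t = joinVec (phiVec K u t) s (phiVec (-K) v t) := by
  have hA := mem_seriesDomain_canonicalA ht
  have h1 := phiVec_intertwine (S := selectRows fun i => blockEquiv m (Sum.inl i)) (A' := K)
    (A := canonicalA K) (matrix_ext_joinVec fun u s v => by
      rw [← Matrix.mulVec_mulVec, ← Matrix.mulVec_mulVec, canonicalA_mulVec, selectRows_mulVec,
        selectRows_mulVec]
      exact (fstBlock_joinVec _ _ _).trans (congrArg _ (fstBlock_joinVec _ _ _).symm)) hA ht
    (joinVec u s v)
  have h2 := phiVec_intertwine (S := selectRows fun i => blockEquiv m (Sum.inr (Sum.inl i)))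
    (A' := 0) (A := canonicalA K) (matrix_ext_joinVec fun u s v => by
      rw [← Matrix.mulVec_mulVec, canonicalA_mulVec, selectRows_mulVec, Matrix.zero_mul,
        Matrix.zero_mulVec]
      exact midBlock_joinVec _ _ _) hA (mem_seriesDomain_zero t) (joinVec u s v)
  have h3 := phiVec_intertwine (S := selectRows fun i => blockEquiv m (Sum.inr (Sum.inr i)))
    (A' := -K) (A := canonicalA K) (matrix_ext_joinVec fun u s v => by
      rw [← Matrix.mulVec_mulVec, ← Matrix.mulVec_mulVec, canonicalA_mulVec, selectRows_mulVec,
        selectRows_mulVec]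
      exact (lastBlock_joinVec _ _ _).trans (congrArg _ (lastBlock_joinVec _ _ _).symm)) hA
    (by rwa [seriesDomain_neg]) (joinVec u s v)
  rw [selectRows_mulVec, selectRows_mulVec] at h1 h2 h3
  rw [← joinVec_blocks (phiVec (canonicalA K) (joinVec u s v) t)]
  have e1 : (fun i => joinVec u s v (blockEquiv m (Sum.inl i))) = u := fstBlock_joinVec u s v
  have e2 : (fun i => joinVec u s v (blockEquiv m (Sum.inr (Sum.inl i)))) = s :=
    midBlock_joinVec u s v
  have e3 : (fun i => joinVec u s v (blockEquiv m (Sum.inr (Sum.inr i)))) = v :=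
    lastBlock_joinVec u s v
  rw [e1] at h1
  rw [e2, phiVec_zero] at h2
  rw [e3] at h3
  exact congr (congr (congrArg joinVec h1) h2) h3

end Blocks

/-! ### The canonical pair -/

section CanonicalPair

variable {m : ℕ}

theorem isLinearFlow_canonical (K : Matrix (Fin (m + 1)) (Fin (m + 1)) ℂ) (C : Fin (2 * m + 3) → ℂ) :
    IsLinearFlow (canonicalA ((1 / 2 : ℂ) • K)) (seriesDomain (canonicalA K))
      (phiVec (canonicalA K) C) := by
  rw [← smul_canonicalA]
  exact isLinearFlow_phiVec _ _

theorem psiVec_canonical (K : Matrix (Fin (m + 1)) (Fin (m + 1)) ℂ) (C : Fin (2 * m + 3) → ℂ)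
    {t : Times} (ht : t ∈ seriesDomain (canonicalA K)) :
    psiVec (canonicalA K) (canonicalT m *ᵥ C) t = canonicalT m *ᵥ phiVec (canonicalA K) C t := by
  rw [psiVec_eq, phiVec_intertwine (canonicalT_mul_canonicalA K) ht (by rwa [seriesDomain_neg])]

/-- If `φ` coincides with an exponential vector on a smaller set of times, the potential still
solves the KdV hierarchy there. -/
theorem solvesKdVHierarchy_of_eq {K : Matrix (Fin (m + 1)) (Fin (m + 1)) ℂ}
    {C : Fin (2 * m + 3) → ℂ} {dom : Set Times} {φ : Times → Fin (2 * m + 3) → ℂ}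
    (hmem : ∀ t ∈ dom, ∀ l s, Function.update t l s ∈ dom)
    (h : ∀ t ∈ dom, t ∈ seriesDomain (canonicalA K) ∧ φ t = phiVec (canonicalA K) C t) :
    SolvesKdVHierarchy {t | t ∈ dom ∧ tauF m φ (fun t => canonicalT m *ᵥ φ t) t ≠ 0}
      (kdvR m φ fun t => canonicalT m *ᵥ φ t) :=
  solvesKdVHierarchy_canonical ((isLinearFlow_canonical K C).congr (fun t ht => (h t ht).1) hmem
    fun t ht => (h t ht).2) fun _ _ => rfl

end CanonicalPair

/-! ### The diagonal case -/

section Diagonal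

variable {m : ℕ}

theorem update_mem_diagDomain {k : Fin (m + 1) → ℂ} {t : Times} (ht : t ∈ diagDomain k) (l : ℕ)
    (s : ℂ) : Function.update t l s ∈ diagDomain k := by
  intro i
  have h1 : Summable fun j : ℕ => t j • k i ^ (2 * j + 1) :=
    (ht i).congr fun j => by rw [smul_eq_mul, mul_comm]
  exact (hasSum_update_time h1 l s).summable.congr fun j => by rw [smul_eq_mul, mul_comm]

theorem hasSum_diagonal {k : Fin (m + 1) → ℂ} {t : Times} (ht : t ∈ diagDomain k) :
    HasSum (fun j : ℕ => t j • Matrix.diagonal k ^ (2 * j + 1))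
      (Matrix.diagonal fun i => ∑' j : ℕ, k i ^ (2 * j + 1) * t j) := by
  have h1 : HasSum (fun (j : ℕ) (i : Fin (m + 1)) => k i ^ (2 * j + 1) * t j)
      fun i => ∑' j : ℕ, k i ^ (2 * j + 1) * t j := Pi.hasSum.mpr fun i => (ht i).hasSum
  convert! h1.matrix_diagonal using 1
  ext1 j
  rw [Matrix.diagonal_pow, ← Matrix.diagonal_smul]
  congr 1
  ext i
  simp [mul_comm]

theorem phiVec_diagonal {k : Fin (m + 1) → ℂ} {t : Times} (ht : t ∈ diagDomain k)
    (c : Fin (m + 1) → ℂ) :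
    phiVec (Matrix.diagonal k) c t = fun i => c i * Complex.exp (xi t (k i)) := by
  rw [phiVec, (hasSum_diagonal ht).tsum_eq, ← Matrix.diagonal_smul, Matrix.exp_diagonal]
  ext i
  rw [Matrix.mulVec_diagonal, mul_comm, Pi.exp_def, Complex.exp_eq_exp_ℂ]
  rfl

theorem neg_mem_diagDomain {k : Fin (m + 1) → ℂ} {t : Times} (ht : t ∈ diagDomain k) :
    t ∈ diagDomain (-k) := fun i =>
  (ht i).neg.congr fun j => by rw [Pi.neg_apply, (odd_two_mul_add_one j).neg_pow, neg_mul]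

theorem diagPhi_eq {k c d : Fin (m + 1) → ℂ} {t : Times} (ht : t ∈ diagDomain k) :
    t ∈ seriesDomain (canonicalA (Matrix.diagonal k)) ∧
      diagPhi k c d t = phiVec (canonicalA (Matrix.diagonal k)) (blockVec c d) t := by
  have h1 : t ∈ seriesDomain (Matrix.diagonal k) := (hasSum_diagonal ht).summable
  refine ⟨mem_seriesDomain_canonicalA h1, ?_⟩
  rw [blockVec_eq, phiVec_canonicalA h1, phiVec_diagonal ht, Matrix.diagonal_neg]
  rw [show (fun i => -k i) = -k from rfl, phiVec_diagonal (neg_mem_diagDomain ht)]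
  rfl

end Diagonal

/-! ### The Jordan case -/

open PowerSeries in
/-- The truncated Taylor column of a power series. -/
def coeffColumn (n : ℕ) (f : ℂ⟦X⟧) : Fin n → ℂ := fun i => coeff (i : ℕ) f

open PowerSeries in
theorem coeffColumn_mul (n : ℕ) (f g : ℂ⟦X⟧) :
    (Matrix.of fun i j : Fin n => coeff (i : ℕ) (X ^ (j : ℕ) * f)) *ᵥ coeffColumn n g =
      coeffColumn n (f * g) := by
  ext i
  simp only [Matrix.mulVec, dotProduct, coeffColumn, Matrix.of_apply, coeff_X_pow_mul']
  rw [Fin.sum_univ_eq_sum_range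
    (fun j => (if j ≤ (i : ℕ) then coeff ((i : ℕ) - j) f else 0) * coeff j g) n, mul_comm f,
    coeff_mul, Finset.Nat.sum_antidiagonal_eq_sum_range_succ_mk]
  symm
  rw [← Finset.sum_subset (Finset.range_subset_range.mpr i.2)
    (fun j _ hj => by rw [if_neg (by simpa using hj), zero_mul])]
  refine Finset.sum_congr rfl fun j hj => ?_
  rw [if_pos (Nat.lt_succ_iff.mp (Finset.mem_range.mp hj)), mul_comm]

open PowerSeries in
/-- Multiplication of power series modulo `Xⁿ`, as lower triangular Toeplitz matrices. -/
def toeplitz (n : ℕ) : ℂ⟦X⟧ →ₐ[ℂ] Matrix (Fin n) (Fin n) ℂ :=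
  AlgHom.ofLinearMap
    { toFun := fun f => Matrix.of fun i j : Fin n => coeff (i : ℕ) (X ^ (j : ℕ) * f)
      map_add' := fun f g => by ext; simp [mul_add]
      map_smul' := fun c f => by ext; simp }
    (by
      ext i j
      simp [coeff_X_pow, Matrix.one_apply, Fin.ext_iff])
    (fun f g => by
      ext i j
      have h := congrFun (coeffColumn_mul n f (X ^ (j : ℕ) * g)) i
      simp only [coeffColumn] at h
      simp only [LinearMap.coe_mk, AddHom.coe_mk, Matrix.of_apply]
      rw [mul_left_comm, ← h]
      rfl)

theorem toeplitz_mulVec (n : ℕ) (f g : PowerSeries ℂ) :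
    toeplitz n f *ᵥ coeffColumn n g = coeffColumn n (f * g) :=
  coeffColumn_mul n f g

open PowerSeries in
theorem toeplitz_apply (n : ℕ) (f : ℂ⟦X⟧) (i j : Fin n) :
    toeplitz n f i j = if (j : ℕ) ≤ i then coeff ((i : ℕ) - j) f else 0 :=
  coeff_X_pow_mul' _ _ _

/-- The Taylor series of the identity at `k` is `k + X`, and `X` acts as the shift below the
diagonal. Functions of the Jordan block thereby become Toeplitz matrices of Taylor series. -/
theorem lowerJordan_eq (n : ℕ) (k : ℂ) :
    lowerJordan n k = toeplitz n (taylorSeries (fun z => z) k) := by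
  ext i j
  rw [toeplitz_apply, lowerJordan, Matrix.of_apply]
  simp only [taylorSeries, PowerSeries.coeff_mk]
  rcases lt_trichotomy (i : ℕ) j with h | h | h
  · rw [if_neg (by rintro rfl; exact lt_irrefl _ h), if_neg (by omega), if_neg (by omega)]
  · obtain rfl := Fin.ext h
    simp
  · rw [if_neg (by rintro rfl; exact lt_irrefl _ h), if_pos h.le]
    obtain ⟨d, hd⟩ := Nat.exists_eq_add_of_lt h
    have : (i : ℕ) - j = d + 1 := by omega
    rw [this, iteratedDeriv_succ']
    simp only [deriv_id'', iteratedDeriv_const]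
    rcases d with _ | d
    · simp [hd]
    · rw [if_neg (by omega)]
      simp

theorem taylorSeries_pow {g : ℂ → ℂ} {x : ℂ} (hg : AnalyticAt ℂ g x) (n : ℕ) :
    taylorSeries (fun z => g z ^ n) x = taylorSeries g x ^ n := by
  induction n with
  | zero => simpa using taylorSeries_const 1 x
  | succ n ih =>
    simp only [pow_succ]
    rw [taylorSeries_mul (hg.fun_pow n) hg, ih]

theorem taylorSeries_const_mul {g : ℂ → ℂ} {x : ℂ} (c : ℂ) (hg : AnalyticAt ℂ g x) :
    taylorSeries (fun z => c * g z) x = c • taylorSeries g x := by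
  rw [taylorSeries_mul analyticAt_const hg, taylorSeries_const, PowerSeries.smul_eq_C_mul]

/-- Weierstrass's theorem: locally uniform convergence of holomorphic functions passes to their
derivatives. -/
theorem hasSum_iteratedDeriv {ι : Type*} {U : Set ℂ} (hU : IsOpen U) {F : ι → ℂ → ℂ} {u : ι → ℝ}
    (hu : Summable u) (hF : ∀ i, DifferentiableOn ℂ (F i) U)
    (hb : ∀ i, ∀ z ∈ U, ‖F i z‖ ≤ u i) (n : ℕ) {k : ℂ} (hk : k ∈ U) :
    HasSum (fun i => iteratedDeriv n (F i) k) (iteratedDeriv n (fun z => ∑' i, F i z) k) := by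
  have key : ∀ n : ℕ, TendstoLocallyUniformlyOn
      (fun (s : Finset ι) z => iteratedDeriv n (fun z => ∑ i ∈ s, F i z) z)
      (iteratedDeriv n fun z => ∑' i, F i z) Filter.atTop U := by
    intro n
    induction n with
    | zero =>
      simpa using (tendstoUniformlyOn_tsum hu hb).tendstoLocallyUniformlyOn
    | succ n ih =>
      simp only [iteratedDeriv_succ]
      refine ih.deriv (Filter.Eventually.of_forall fun s z hz => ?_) hU
      have ha : AnalyticAt ℂ (fun z => ∑ i ∈ s, F i z) z :=
        (DifferentiableOn.fun_sum fun i _ => hF i).analyticAt (hU.mem_nhds hz)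
      rw [iteratedDeriv_eq_iterate]
      exact (ha.iterated_deriv n).differentiableAt.differentiableWithinAt
  have h := (key n).tendsto_at hk
  refine h.congr fun s => ?_
  have ha : ∀ i ∈ s, ContDiffAt ℂ n (F i) k := fun i _ =>
    ((hF i).analyticAt (hU.mem_nhds hk)).contDiffAt
  exact iteratedDeriv_fun_sum ha

theorem hasSum_toeplitz {ι : Type*} {U : Set ℂ} (hU : IsOpen U) {F : ι → ℂ → ℂ} {u : ι → ℝ}
    (hu : Summable u) (hF : ∀ i, DifferentiableOn ℂ (F i) U)
    (hb : ∀ i, ∀ z ∈ U, ‖F i z‖ ≤ u i) (n : ℕ) {k : ℂ} (hk : k ∈ U) :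
    HasSum (fun i => toeplitz n (taylorSeries (F i) k))
      (toeplitz n (taylorSeries (fun z => ∑' i, F i z) k)) := by
  refine Pi.hasSum.mpr fun a => Pi.hasSum.mpr fun b => ?_
  simp only [toeplitz_apply, taylorSeries, PowerSeries.coeff_mk]
  split_ifs
  · exact (hasSum_iteratedDeriv hU hu hF hb _ hk).div_const _
  · exact hasSum_zero

/-- `toeplitz` is an algebra homomorphism, so it can be applied to the exponential series term by
term. A neighbourhood on which `‖g‖ < ‖g k‖ + 1` provides the summable bound. -/
theorem exp_toeplitz {g : ℂ → ℂ} {k : ℂ} (hg : AnalyticAt ℂ g k) (n : ℕ) :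
    NormedSpace.exp (toeplitz n (taylorSeries g k)) =
      toeplitz n (taylorSeries (fun z => Complex.exp (g z)) k) := by
  have hev : ∀ᶠ z in 𝓝 k, AnalyticAt ℂ g z ∧ ‖g z‖ < ‖g k‖ + 1 :=
    hg.eventually_analyticAt.and (hg.continuousAt.norm.eventually_lt continuousAt_const (by simp))
  obtain ⟨U, hUs, hU, hk⟩ := eventually_nhds_iff.mp hev
  have hs := hasSum_toeplitz hU (F := fun i z => (Nat.factorial i : ℂ)⁻¹ * g z ^ i)
    (Real.summable_pow_div_factorial (‖g k‖ + 1))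
    (fun i z hz => (((hUs z hz).1.differentiableAt.pow i).const_mul _).differentiableWithinAt)
    (fun i z hz => by
      rw [norm_mul, norm_inv, norm_pow, Complex.norm_natCast, div_eq_inv_mul]
      gcongr
      exact (hUs z hz).2.le) n hk
  have h2 : (fun z => ∑' i : ℕ, (Nat.factorial i : ℂ)⁻¹ * g z ^ i) =
      fun z => Complex.exp (g z) := by
    ext z
    rw [Complex.exp_eq_exp_ℂ, NormedSpace.exp_eq_tsum ℂ]
    simp
  rw [h2] at hs
  refine (hasSum_exp _).unique ?_
  convert hs using 2 with i
  rw [taylorSeries_const_mul _ (hg.fun_pow i), taylorSeries_pow hg, map_smul, map_pow]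

/-- If the series converged at no point farther from `0` than `k`, the closed disc of radius `‖k‖`
would be a neighbourhood of its boundary point `k`. Convergence at some `z` with `‖z‖ > ‖k‖` bounds
the terms on the whole disc of radius `‖z‖`. -/
theorem exists_ball_of_mem_jordanDomain {k : ℂ} {t : Times} (ht : t ∈ jordanDomain k) :
    ∃ ρ : ℝ, ‖k‖ < ρ ∧ ∃ u : ℕ → ℝ, Summable u ∧
      ∀ j, ∀ z ∈ Metric.ball (0 : ℂ) ρ, ‖z ^ (2 * j + 1) * t j‖ ≤ u j := by
  obtain ⟨z, hz, hs⟩ : ∃ z : ℂ, ‖k‖ < ‖z‖ ∧ Summable fun j : ℕ => z ^ (2 * j + 1) * t j := by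
    by_contra! hcon
    have h1 : Metric.closedBall (0 : ℂ) ‖k‖ ∈ 𝓝 k := by
      filter_upwards [ht] with z hz
      by_contra h
      exact hcon z (by simpa using h) hz
    have h2 := mem_interior_iff_mem_nhds.mpr h1
    rw [interior_closedBall'] at h2
    simp at h2
  refine ⟨‖z‖, hz, _, hs.norm, fun j w hw => ?_⟩
  rw [norm_mul, norm_mul, norm_pow, norm_pow]
  have : ‖w‖ ≤ ‖z‖ := by simpa using (Metric.mem_ball.mp hw).le
  gcongr

theorem hasSum_lowerJordan {k : ℂ} {t : Times} (ht : t ∈ jordanDomain k) (n : ℕ) :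
    AnalyticAt ℂ (xi t) k ∧
    HasSum (fun j : ℕ => t j • lowerJordan n k ^ (2 * j + 1))
      ((2 : ℂ) • toeplitz n (taylorSeries (xi t) k)) := by
  obtain ⟨ρ, hρ, u, hu, hb⟩ := exists_ball_of_mem_jordanDomain ht
  have hk : k ∈ Metric.ball (0 : ℂ) ρ := by simpa using hρ
  have hd : ∀ j : ℕ, DifferentiableOn ℂ (fun z : ℂ => z ^ (2 * j + 1) * t j)
      (Metric.ball (0 : ℂ) ρ) := fun j => by fun_prop
  have ha : AnalyticAt ℂ (fun z : ℂ => ∑' j : ℕ, z ^ (2 * j + 1) * t j) k :=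
    (Complex.differentiableOn_tsum_of_summable_norm hu hd Metric.isOpen_ball
      hb).analyticAt (Metric.isOpen_ball.mem_nhds hk)
  refine ⟨analyticAt_const.mul ha, ?_⟩
  have hs := hasSum_toeplitz Metric.isOpen_ball hu hd hb n hk
  have e : taylorSeries (xi t) k =
      (1 / 2 : ℂ) • taylorSeries (fun z : ℂ => ∑' j : ℕ, z ^ (2 * j + 1) * t j) k :=
    taylorSeries_const_mul _ ha
  rw [e, map_smul, smul_smul, show (2 : ℂ) * (1 / 2) = 1 by norm_num, one_smul]
  convert hs using 2 with j
  rw [lowerJordan_eq, ← map_pow, ← taylorSeries_pow (g := fun z => z) analyticAt_id,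
    ← map_smul, ← taylorSeries_const_mul (g := fun z => z ^ (2 * j + 1)) _ (analyticAt_id.pow _)]
  simp only [mul_comm]

theorem xi_neg (t : Times) (z : ℂ) : xi t (-z) = -xi t z := by
  simp only [xi, (odd_two_mul_add_one _).neg_pow, neg_mul, tsum_neg, mul_neg]

theorem phiVec_neg {N : ℕ} (A : Matrix (Fin N) (Fin N) ℂ) (C : Fin N → ℂ) (t : Times) :
    phiVec (-A) C t = NormedSpace.exp (-((1 / 2 : ℂ) • ∑' j : ℕ, t j • A ^ (2 * j + 1))) *ᵥ C := by
  rw [← psiVec_eq, psiVec]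

/-- A Toeplitz matrix acting on a Taylor column is multiplication of truncated Taylor series, which
is how the derivatives of the product with `c` arise. -/
theorem exp_toeplitz_mulVec_taylorColumn {g c : ℂ → ℂ} {k : ℂ} (hg : AnalyticAt ℂ g k)
    (hc : AnalyticAt ℂ c k) (m : ℕ) :
    NormedSpace.exp (toeplitz (m + 1) (taylorSeries g k)) *ᵥ taylorColumn m c k =
      taylorColumn m (fun z => c z * Complex.exp (g z)) k := by
  have e : ∀ F : ℂ → ℂ, taylorColumn m F k = coeffColumn (m + 1) (taylorSeries F k) := fun F => by
    ext i
    simp [taylorColumn, coeffColumn, taylorSeries]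
  rw [exp_toeplitz hg, e, e, toeplitz_mulVec, taylorSeries_mul hc hg.cexp', mul_comm]

theorem jordanPhi_eq {m : ℕ} {k : ℂ} {c d : ℂ → ℂ} (hc : AnalyticAt ℂ c k) (hd : AnalyticAt ℂ d k)
    {t : Times} (ht : t ∈ jordanDomain k) :
    t ∈ seriesDomain (canonicalA (lowerJordan (m + 1) k)) ∧
      jordanPhi m k c d t = phiVec (canonicalA (lowerJordan (m + 1) k))
        (blockVec (taylorColumn m c k) (taylorColumn m d k)) t := by
  obtain ⟨hxi, hs⟩ := hasSum_lowerJordan ht (m + 1)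
  have h1 : t ∈ seriesDomain (lowerJordan (m + 1) k) := hs.summable
  refine ⟨mem_seriesDomain_canonicalA h1, ?_⟩
  have h2 : (1 / 2 : ℂ) • ∑' j : ℕ, t j • lowerJordan (m + 1) k ^ (2 * j + 1) =
      toeplitz (m + 1) (taylorSeries (xi t) k) := by
    rw [hs.tsum_eq, smul_smul, show (1 / 2 : ℂ) * 2 = 1 by norm_num, one_smul]
  have h3 : -toeplitz (m + 1) (taylorSeries (xi t) k) =
      toeplitz (m + 1) (taylorSeries (fun z => -xi t z) k) := by
    have := taylorSeries_const_mul (-1) hxi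
    simp only [neg_mul, one_mul, neg_smul, one_smul] at this
    rw [this, map_neg]
  rw [blockVec_eq, phiVec_canonicalA h1, phiVec_neg, phiVec, h2, h3,
    exp_toeplitz_mulVec_taylorColumn hxi hc, exp_toeplitz_mulVec_taylorColumn hxi.fun_neg hd,
    jordanPhi, blockVec_eq]
  -- The block of `-K` yields `e^{-ξ(z)}`; since `ξ` is odd, this is `e^{ξ(-z)}`.
  simp only [xi_neg]

theorem update_mem_jordanDomain {k : ℂ} {t : Times} (ht : t ∈ jordanDomain k) (l : ℕ) (s : ℂ) :
    Function.update t l s ∈ jordanDomain k := by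
  filter_upwards [ht] with z hz
  have h1 : Summable fun j : ℕ => t j • z ^ (2 * j + 1) :=
    hz.congr fun j => by rw [smul_eq_mul, mul_comm]
  exact (hasSum_update_time h1 l s).summable.congr fun j => by rw [smul_eq_mul, mul_comm]

end

theorem mainTheorem8 (m : ℕ) :
    -- each step of the AKNS recursion is a well-defined differential polynomial
    (∀ n : ℕ, ∃! Q : DiffPoly,
      totalDeriv Q = aknsDensity (aknsFlow n) ∧ MvPolynomial.constantCoeff Q = 0) ∧
    -- passing to a similar pair `(A, T)` changes neither the equations nor `q` and `r`
    (∀ A T P : Matrix (Fin (2 * m + 3)) (Fin (2 * m + 3)) ℂ, IsUnit P.det →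
      A * T + T * A = 0 → T ^ 2 = 1 →
      (P * A * P⁻¹) * (P * T * P⁻¹) + (P * T * P⁻¹) * (P * A * P⁻¹) = 0 ∧
      (P * T * P⁻¹) ^ 2 = 1 ∧
      ∀ C : Fin (2 * m + 3) → ℂ, ∀ t ∈ seriesDomain A,
        t ∈ seriesDomain (P * A * P⁻¹) ∧
        kdvQ m (phiVec (P * A * P⁻¹) (P *ᵥ C))
            (psiVec (P * A * P⁻¹) ((P * T * P⁻¹) *ᵥ (P *ᵥ C))) t =
          kdvQ m (phiVec A C) (psiVec A (T *ᵥ C)) t ∧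
        kdvR m (phiVec (P * A * P⁻¹) (P *ᵥ C))
            (psiVec (P * A * P⁻¹) ((P * T * P⁻¹) *ᵥ (P *ᵥ C))) t =
          kdvR m (phiVec A C) (psiVec A (T *ᵥ C)) t) ∧
    -- the determinant of the canonical `T`
    (canonicalT m).det = (-1) ^ (m + 1) ∧
    -- the canonical pair, for every `K` and every `C⁺`
    (∀ K : Matrix (Fin (m + 1)) (Fin (m + 1)) ℂ,
      canonicalA K * canonicalT m + canonicalT m * canonicalA K = 0 ∧
      canonicalT m ^ 2 = 1 ∧
      ∀ (C : Fin (2 * m + 3) → ℂ) (φ ψ : Times → Fin (2 * m + 3) → ℂ),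
        φ = phiVec (canonicalA K) C → ψ = psiVec (canonicalA K) (canonicalT m *ᵥ C) →
        (∀ t ∈ seriesDomain (canonicalA K), ψ t = canonicalT m *ᵥ φ t) ∧
        (∀ t ∈ seriesDomain (canonicalA K), tauF m φ ψ t ≠ 0 →
          kdvQ m φ ψ t = (canonicalT m).det) ∧
        SolvesKdVHierarchy {t | t ∈ seriesDomain (canonicalA K) ∧ tauF m φ ψ t ≠ 0}
          (kdvR m φ ψ)) ∧
    -- the diagonal case
    (∀ (k c d : Fin (m + 1) → ℂ) (φ ψ : Times → Fin (2 * m + 3) → ℂ),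
      φ = diagPhi k c d → ψ = (fun t => canonicalT m *ᵥ φ t) →
      (∀ t ∈ diagDomain k, t ∈ seriesDomain (canonicalA (Matrix.diagonal k)) ∧
        φ t = phiVec (canonicalA (Matrix.diagonal k)) (blockVec c d) t) ∧
      SolvesKdVHierarchy {t | t ∈ diagDomain k ∧ tauF m φ ψ t ≠ 0} (kdvR m φ ψ)) ∧
    -- the Jordan case
    (∀ (k : ℂ) (c d : ℂ → ℂ), AnalyticAt ℂ c k → AnalyticAt ℂ d k →
      ∀ φ ψ : Times → Fin (2 * m + 3) → ℂ,
      φ = jordanPhi m k c d → ψ = (fun t => canonicalT m *ᵥ φ t) →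
      (∀ t ∈ jordanDomain k, t ∈ seriesDomain (canonicalA (lowerJordan (m + 1) k)) ∧
        φ t = phiVec (canonicalA (lowerJordan (m + 1) k))
          (blockVec (taylorColumn m c k) (taylorColumn m d k)) t) ∧
      SolvesKdVHierarchy {t | t ∈ jordanDomain k ∧ tauF m φ ψ t ≠ 0} (kdvR m φ ψ)) := by
  refine ⟨existsUnique_antiderivative, fun A T P hP hAT hT => ⟨similar_anticommute hP hAT,
      similar_sq hP hT, fun C t ht => ⟨mem_seriesDomain_similar hP ht, ?_, ?_⟩⟩, canonicalT_det,
    fun K => ⟨?_, canonicalT_sq, fun C φ ψ hφ hψ => ?_⟩, fun k c d φ ψ hφ hψ => ?_,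
    fun k c d hc hd φ ψ hφ hψ => ?_⟩
  · simp only [kdvQ, tauH, tauF, doubleWronskian_similar hP T C ht]
    exact mul_div_mul_left _ _ hP.ne_zero
  · simp only [kdvR, tauG, tauF, doubleWronskian_similar hP T C ht]
    rw [mul_left_comm, mul_div_mul_left _ _ hP.ne_zero]
  · rw [canonicalT_mul_canonicalA, Matrix.neg_mul, add_neg_cancel]
  · subst hφ hψ
    have hflow := isLinearFlow_canonical K C
    have hT : ∀ t ∈ seriesDomain (canonicalA K), psiVec (canonicalA K) (canonicalT m *ᵥ C) t =
        canonicalT m *ᵥ phiVec (canonicalA K) C t := fun t ht => psiVec_canonical K C ht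
    exact ⟨hT, fun t ht => kdvQ_canonical hflow hT ht, solvesKdVHierarchy_canonical hflow hT⟩
  · subst hφ hψ
    have h : ∀ t ∈ diagDomain k, _ := fun t ht => diagPhi_eq (c := c) (d := d) ht
    exact ⟨h, solvesKdVHierarchy_of_eq (fun t ht => update_mem_diagDomain ht) h⟩
  · subst hφ hψ
    have h : ∀ t ∈ jordanDomain k, _ := fun t ht => jordanPhi_eq (m := m) hc hd ht
    exact ⟨h, solvesKdVHierarchy_of_eq (fun t ht => update_mem_jordanDomain ht) h⟩
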